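/- Let $\beta=p/q>1$ be a non-integer rational number in lowest terms. For $c\in\mathbb C$ let $\mathbf f_c$ be the correspondence $z\mapsto w$ given by $(w-c)^q=z^p$ (that is, $w\in z^\beta+c$), and let $J(\mathbf f_c)$ be the closure of the union of its repelling cycles (cycles avoiding $0$ and $\infty$ along which the composition of the branches of $\mathbf f_c$ has derivative of modulus $>1$). A compact $\Lambda\subset\mathbb C\setminus\{0\}$ is semi-invariant under $\mathbf f_c$ if each of its points has an image and a pre-image in $\Lambda$; it is expanding hyperbolic if moreover the branches of $\mathbf f_c$ uniformly expand a conformal metric on a region containing $\Lambda$. Real numbers $r,\delta>0$ are admissible for $(c,\Lambda)$ if $4|c|r<1$, $\Lambda$ is compact and semi-invariant, $r<|z|<\frac1{2r}$ and $r<|z-c|<\frac1{2r}$ for $z\in\Lambda$, and for each $z\in\Lambda$ the closed disks of radius $\delta$ centred at the points $rw$, $w\in\mathbf f_c(z)\cap\Lambda$, are pairwise disjoint and contained in the closed unit disk. The Cantor bundle $\mathcal B(\Lambda)=\mathcal B_{r,\delta}(\Lambda)\subset\mathbb C^2$ is the set of the points $(z_0,\ r\sum_{n\ge1}\delta^{n-1}z_n)$,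 where $z_0\to z_1\to\cdots$ runs through the forward orbits of $\mathbf f_c$ in $\Lambda$ (equivalently, $\bigcup_{z\in\Lambda}\{z\}\times\bigcap_{n>0}\mathcal D_n(z)$, where $\mathcal D_n(z)$ is the union of the closed disks with centre $r\sum_{k=1}^n\delta^{k-1}z_k$ and radius $\delta^n$ over such orbits with $z_0=z$). Its bundle map $f_c$, defined on a small neighbourhood of $\mathcal B(\Lambda)$, is $f_c(z,w)=(\varphi(z),\ \delta^{-1}w-r\delta^{-1}\varphi(z))$, where, near the point encoding $(z_n)$, $\varphi$ is the branch of $\mathbf f_c$ with $\varphi(z_0)=z_1$. For $\Lambda=J(\mathbf f_c)$, the closure of the set of periodic points of $f_c$ is denoted $J(f_c)$. Let $\pi(z,w)=z$. Let $0<r<\frac12$. Then there is $\delta$ such that $(r,\delta)$ is admissible for $c=0$ and $\Lambda=\mathbb S^1$. For every such $\delta$ the following holds. We have $J(\mathbf f_0)=\mathbb S^1$ and $J(f_0)=\mathcal B(\mathbb S^1)$, and this set is homeomorphic to the $q$-adic solenoid (the inverse limit of $z\mapsto z^q$ on $\mathbb S^1$). There are a connected open neighbourhood $U$ of $0$ in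 $\mathbb C$ and a holomorphic motion $h:U\times\mathcal B(\mathbb S^1)\to\mathbb C^2$ based at $0$ (that is, $h_0=\mathrm{id}$, each $h_c$ is injective, and $c\mapsto h_c(x)$ is holomorphic on $U$ for each $x$) such that, with $\Lambda_c=\pi h_c(\mathcal B(\mathbb S^1))$: (i) for every $c\in U$ the set $\Lambda_c$ is an expanding hyperbolic set of $\mathbf f_c$ for which $(r,\delta)$ is admissible, and $\Lambda_c$ varies continuously with $c\in U$ in the Hausdorff metric; each $h_c$ is continuous, its image is contained in $\mathcal B(\Lambda_c)$ and is invariant under $f_c$, and $h_c\circ f_0=f_c\circ h_c$ on $\mathcal B(\mathbb S^1)$; and there is $C>0$ with $|h_u(x)-h_v(x)|\le C|u-v|$ for all $u,v\in U$ and $x\in\mathcal B(\mathbb S^1)$; (ii) for every $c\in U$ the Julia set of $z^\beta+c$ is the projection of the quasi-solenoid $h_c(\mathcal B(\mathbb S^1))$, and the latter is $J(f_c)$: $$J(\mathbf f_c)=\pi\bigl(h_c(\mathcal B(\mathbb S^1))\bigr),\qquad h_c(\mathcal B(\mathbb S^1))=J(f_c).$$ -/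

import Mathlib

open Set Filter Topology

noncomputable section

/-- The correspondence `z ↦ w` given by `(w - c)^q = z^p`. When `β = p/q` is in lowest terms
its images of `z` are the values of the multifunction `z^β + c`. -/
def Corr (p q : ℕ) (c z w : ℂ) : Prop := (w - c) ^ q = z ^ p

/-- `φ` is (the germ at `z` of) a holomorphic branch of the correspondence. -/
def IsBranchAt (p q : ℕ) (c : ℂ) (φ : ℂ → ℂ) (z : ℂ) : Prop :=
  AnalyticAt ℂ φ z ∧ ∀ᶠ x in 𝓝 z, Corr p q c x (φ x)

/-- `φ (n-1) ∘ ⋯ ∘ φ 0`. -/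
def branchComp (φ : ℕ → ℂ → ℂ) : ℕ → ℂ → ℂ
  | 0 => id
  | n + 1 => φ n ∘ branchComp φ n

/-- `z 0 → z 1 → ⋯ → z n = z 0` (with `n ≥ 1`) is a repelling cycle: no point of it is `0`, and
the composition of the branches along the cycle has derivative of modulus `> 1` at `z 0`. -/
def IsRepellingCycle (p q : ℕ) (c : ℂ) (n : ℕ) (z : ℕ → ℂ) : Prop :=
  1 ≤ n ∧ z n = z 0 ∧ (∀ k < n, z k ≠ 0) ∧
    ∃ φ : ℕ → ℂ → ℂ,
      (∀ k < n, IsBranchAt p q c (φ k) (z k) ∧ φ k (z k) = z (k + 1)) ∧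
      1 < ‖deriv (branchComp φ n) (z 0)‖

/-- The Julia set of the correspondence: the closure of the union of all repelling cycles. -/
def juliaSet (p q : ℕ) (c : ℂ) : Set ℂ :=
  closure {x | ∃ (n : ℕ) (z : ℕ → ℂ), IsRepellingCycle p q c n z ∧ ∃ k < n, x = z k}

/-- Every point of `Λ` has at least one image and at least one pre-image in `Λ`. -/
def SemiInvariant (p q : ℕ) (c : ℂ) (Λ : Set ℂ) : Prop :=
  (∀ z ∈ Λ, ∃ w ∈ Λ, Corr p q c z w) ∧ (∀ z ∈ Λ, ∃ w ∈ Λ, Corr p q c w z)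

/-- The annulus `r < |z| < 1/(2r)`. -/
def annulusA (r : ℝ) : Set ℂ := {z | r < ‖z‖ ∧ ‖z‖ < 1 / (2 * r)}

/-- The class of compact semi-invariant subsets of `A_r ∩ (c + A_r)`. -/
def InvClass (p q : ℕ) (c : ℂ) (r : ℝ) (Λ : Set ℂ) : Prop :=
  IsCompact Λ ∧ SemiInvariant p q c Λ ∧ ∀ z ∈ Λ, z ∈ annulusA r ∧ z - c ∈ annulusA r

/-- Expanding hyperbolic set: a compact semi-invariant subset of the punctured plane such that
the branches expand, by a factor bounded away from `1`, a conformal metric `μ(z)|dz|` defined on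
a region `V ⊇ Λ`. -/
def IsExpandingHyperbolic (p q : ℕ) (c : ℂ) (Λ : Set ℂ) : Prop :=
  IsCompact Λ ∧ (0 : ℂ) ∉ Λ ∧ SemiInvariant p q c Λ ∧
    ∃ (V : Set ℂ) (μ : ℂ → ℝ), IsOpen V ∧ IsConnected V ∧ Λ ⊆ V ∧
      ContinuousOn μ V ∧ (∀ z ∈ V, 0 < μ z) ∧
      ∃ κ : ℝ, 1 < κ ∧ ∀ z ∈ V, ∀ φ : ℂ → ℂ, IsBranchAt p q c φ z → φ z ∈ V →
        κ ≤ μ (φ z) * ‖deriv φ z‖ / μ z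

/-- The parameters `(r, δ)` are admissible for the bundle over `Λ`: the closed disks of radius `δ`
centred at the points of `r (f_c(z) ∩ Λ)` are pairwise disjoint and contained in the closed unit
disk, for each `z ∈ Λ`. -/
def Admissible (p q : ℕ) (c : ℂ) (Λ : Set ℂ) (r δ : ℝ) : Prop :=
  0 < r ∧ 4 * ‖c‖ * r < 1 ∧ InvClass p q c r Λ ∧ 0 < δ ∧
    ∀ z ∈ Λ, ∀ w ∈ Λ, Corr p q c z w →
      Metric.closedBall ((r : ℂ) * w) δ ⊆ Metric.closedBall 0 1 ∧
      ∀ w' ∈ Λ, Corr p q c z w' → w' ≠ w →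
        Disjoint (Metric.closedBall ((r : ℂ) * w) δ) (Metric.closedBall ((r : ℂ) * w') δ)

/-- Forward orbits contained in `Λ`. -/
def IsOrbitIn (p q : ℕ) (c : ℂ) (Λ : Set ℂ) (ζ : ℕ → ℂ) : Prop :=
  (∀ n, ζ n ∈ Λ) ∧ ∀ n, Corr p q c (ζ n) (ζ (n + 1))

/-- The union of the disks `r (z₁ + δ z₂ + ⋯ + δ^(n-1) z_n) + δ^n 𝔻̄` over all forward orbits
`z → z₁ → z₂ → ⋯` in `Λ`. -/
def diskLevel (p q : ℕ) (c : ℂ) (Λ : Set ℂ) (r δ : ℝ) (n : ℕ) (z : ℂ) : Set ℂ :=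
  ⋃ ζ ∈ {ζ : ℕ → ℂ | IsOrbitIn p q c Λ ζ ∧ ζ 0 = z},
    Metric.closedBall ((r : ℂ) * ∑ k ∈ Finset.range n, (δ : ℂ) ^ k * ζ (k + 1)) (δ ^ n)

/-- The fibre over `z` of the Cantor bundle. -/
def cantorFibre (p q : ℕ) (c : ℂ) (Λ : Set ℂ) (r δ : ℝ) (z : ℂ) : Set ℂ :=
  ⋂ n ∈ {n : ℕ | 0 < n}, diskLevel p q c Λ r δ n z

/-- The (forward) Cantor bundle `𝓑(Λ) = ⋃_{z ∈ Λ} {z} × 𝓒(z)` in `ℂ²`. -/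
def cantorBundle (p q : ℕ) (c : ℂ) (Λ : Set ℂ) (r δ : ℝ) : Set (ℂ × ℂ) :=
  {x | x.1 ∈ Λ ∧ x.2 ∈ cantorFibre p q c Λ r δ x.1}

/-- The point `(ζ₀, r (ζ₁ + δ ζ₂ + δ² ζ₃ + ⋯))` of `ℂ²` that encodes a forward orbit. -/
def bundlePoint (r δ : ℝ) (ζ : ℕ → ℂ) : ℂ × ℂ :=
  (ζ 0, (r : ℂ) * ∑' k : ℕ, (δ : ℂ) ^ k * ζ (k + 1))

/-- `f` is the bundle map on the `η`-neighbourhood of `𝓑(Λ)`: within distance `η` of the point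
encoding the orbit `ζ` it is `(z, w) ↦ (φ(z), δ⁻¹ w - r δ⁻¹ φ(z))`, with `φ` the branch of the
correspondence that takes `ζ₀` to `ζ₁`. -/
def IsBundleMap (p q : ℕ) (c : ℂ) (Λ : Set ℂ) (r δ η : ℝ) (f : ℂ × ℂ → ℂ × ℂ) : Prop :=
  0 < η ∧ ∀ ζ : ℕ → ℂ, IsOrbitIn p q c Λ ζ →
    ∃ φ : ℂ → ℂ, DifferentiableOn ℂ φ (Metric.ball (ζ 0) η) ∧
      (∀ z ∈ Metric.ball (ζ 0) η, Corr p q c z (φ z)) ∧ φ (ζ 0) = ζ 1 ∧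
      ∀ x ∈ Metric.ball (bundlePoint r δ ζ) η,
        f x = (φ x.1, (δ : ℂ)⁻¹ * x.2 - (r : ℂ) * (δ : ℂ)⁻¹ * φ x.1)

/-- The closure of the set of periodic points of a map `f : W → ℂ²` (cycles are required to be
contained in the domain `W`). -/
def closurePeriodic (W : Set (ℂ × ℂ)) (f : ℂ × ℂ → ℂ × ℂ) : Set (ℂ × ℂ) :=
  closure {x | ∃ n : ℕ, 1 ≤ n ∧ (∀ k < n, f^[k] x ∈ W) ∧ f^[n] x = x}

/-- `S` is the Julia set of the bundle map of `𝓑(Λ)`: the bundle map is defined on some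
neighbourhood of `𝓑(Λ)`, and `S` is the closure of its periodic points, for that and for every
smaller neighbourhood. -/
def IsBundleJulia (p q : ℕ) (c : ℂ) (Λ : Set ℂ) (r δ : ℝ) (S : Set (ℂ × ℂ)) : Prop :=
  ∃ η₀ : ℝ, (∃ f, IsBundleMap p q c Λ r δ η₀ f) ∧
    ∀ η ≤ η₀, ∀ f, IsBundleMap p q c Λ r δ η f →
      closurePeriodic (Metric.thickening η (cantorBundle p q c Λ r δ)) f = S

/-- `h : U × A → ℂ²` is a holomorphic motion based at `c₀`. -/
structure IsHolomorphicMotion (U : Set ℂ) (A : Set (ℂ × ℂ)) (c₀ : ℂ)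
    (h : ℂ → ℂ × ℂ → ℂ × ℂ) : Prop where
  isOpen : IsOpen U
  isConnected : IsConnected U
  base_mem : c₀ ∈ U
  base_eq : ∀ x ∈ A, h c₀ x = x
  injOn : ∀ c ∈ U, InjOn (h c) A
  holo : ∀ x ∈ A, DifferentiableOn ℂ (fun c => h c x) U

/-- `h` is a holomorphic motion, based at `c₀`, of the Cantor bundle of the expanding hyperbolic
set `Λ₀` of the correspondence with parameter `c₀`, which carries bundles to bundles and
conjugates the bundle maps. Here `Λ_c = π h_c(𝓑(Λ₀))`. -/
structure IsBundleMotion (p q : ℕ) (c₀ : ℂ) (Λ₀ : Set ℂ) (r δ : ℝ) (U : Set ℂ)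
    (h : ℂ → ℂ × ℂ → ℂ × ℂ) : Prop where
  motion : IsHolomorphicMotion U (cantorBundle p q c₀ Λ₀ r δ) c₀ h
  /-- each `Λ_c` is an expanding hyperbolic set -/
  hyperbolic : ∀ c ∈ U,
    IsExpandingHyperbolic p q c (Prod.fst '' (h c '' cantorBundle p q c₀ Λ₀ r δ))
  /-- `(r, δ)` may be used to form the bundle over `Λ_c` -/
  admissible : ∀ c ∈ U,
    Admissible p q c (Prod.fst '' (h c '' cantorBundle p q c₀ Λ₀ r δ)) r δ
  /-- `Λ_c` varies continuously in the Hausdorff metric -/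
  hausdorff : ∀ c ∈ U,
    Tendsto (fun c' => Metric.hausdorffEDist
      (Prod.fst '' (h c' '' cantorBundle p q c₀ Λ₀ r δ))
      (Prod.fst '' (h c '' cantorBundle p q c₀ Λ₀ r δ))) (𝓝[U] c) (𝓝 0)
  /-- `h_c` is continuous (so it is a homeomorphism of the compact bundle onto its image) -/
  continuousOn : ∀ c ∈ U, ContinuousOn (h c) (cantorBundle p q c₀ Λ₀ r δ)
  /-- the image of `h_c` lies in the bundle over `Λ_c` -/
  mapsTo : ∀ c ∈ U, MapsTo (h c) (cantorBundle p q c₀ Λ₀ r δ)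
    (cantorBundle p q c (Prod.fst '' (h c '' cantorBundle p q c₀ Λ₀ r δ)) r δ)
  /-- `h_c` conjugates the bundle maps, and its image is invariant -/
  conj : ∀ c ∈ U, ∃ (η₀ η : ℝ) (f₀ f : ℂ × ℂ → ℂ × ℂ),
    IsBundleMap p q c₀ Λ₀ r δ η₀ f₀ ∧
    IsBundleMap p q c (Prod.fst '' (h c '' cantorBundle p q c₀ Λ₀ r δ)) r δ η f ∧
    MapsTo f (h c '' cantorBundle p q c₀ Λ₀ r δ) (h c '' cantorBundle p q c₀ Λ₀ r δ) ∧
    ∀ x ∈ cantorBundle p q c₀ Λ₀ r δ, h c (f₀ x) = f (h c x)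
  /-- Lipschitz dependence on the parameter, uniform over the bundle -/
  lipschitz : ∃ C : ℝ, 0 < C ∧ ∀ u ∈ U, ∀ v ∈ U, ∀ x ∈ cantorBundle p q c₀ Λ₀ r δ,
    ‖h u x - h v x‖ ≤ C * ‖u - v‖

/-- The `q`-adic solenoid: the inverse limit of `z ↦ z^q` on the unit circle. -/
abbrev Solenoid (q : ℕ) : Type := {ζ : ℕ → Circle // ∀ n, ζ (n + 1) ^ q = ζ n}

/-- The numerator of `β > 0` in lowest terms, as a natural number. -/
abbrev numNat (β : ℚ) : ℕ := β.num.toNat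

end

/-! Over an admissible set, the second coordinate of an encoded orbit lies in the disk of radius δ
about r z₁. These disks are disjoint for different images of z₀, so z₁ can be read off, and
inductively the whole orbit. Thus 𝓑(Λ) is a copy of the compact space of forward orbits in Λ, on
which the bundle map acts as the shift (`Admissible.injOn_bundlePoint`,
`Admissible.cantorBundle_eq`, `IsBundleMap.apply_bundlePoint`). Everything becomes a question about
orbits.

For c = 0 an orbit on the circle satisfies z_{n+1}^q = z_n^p. As p and q are coprime, z_n =
u_n^(p^n) for a unique point u of the q-adic solenoid. The first N + 1 terms are monomials in u_N;
replacing u_N by a root of unity whose order divides p^m - q^m gives a periodic orbit, so periodic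
orbits are dense (`exists_periodic_near`).

For small c, the ansatz w_n = ζ_n exp(s_n) turns (w_{n+1} - c)^q = w_n^p into s_n = κ (s_{n+1} +
log(1 - c/w_{n+1})) with κ = q/p < 1. This is a contraction in the direction of the future, so there
is exactly one solution in the unit disk; it is holomorphic in c, continuous in ζ and commutes with
the shift. Encoding w in place of ζ gives the motion h.

Conversely, every bounded orbit bounded away from 0 arises in this way
(`ContractionBound.exists_motionOrbit_eq`): the same equation, with w given, is solved by a
geometric series, and the resulting unperturbed orbit ζ satisfies log|ζ_n| = κ log|ζ_{n+1}| with
bounded logarithms, hence lies on the circle. So h_c maps onto the whole bundle over Λ_c.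

For the Julia sets, a cycle meeting the disk |z| ≤ κ^q stays in it and is not repelling, while any
other cycle is a bounded orbit away from 0 and so lies in Λ_c. Periodic displaced orbits are
repelling and dense. A periodic point of f_c near the bundle projects to such an orbit, and its
second coordinate is forced because the fibres are expanded by 1/δ. -/

/-! ### Orbits and the points that encode them -/

/-- The shifted sequence `n ↦ ζ (n + 1)`. -/
def orbitShift (ζ : ℕ → ℂ) : ℕ → ℂ := fun n => ζ (n + 1)

/-- The set of forward orbits contained in `Λ`. -/
def orbitSet (p q : ℕ) (c : ℂ) (Λ : Set ℂ) : Set (ℕ → ℂ) := {ζ | IsOrbitIn p q c Λ ζ}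

theorem IsOrbitIn.shift {p q : ℕ} {c : ℂ} {Λ : Set ℂ} {ζ : ℕ → ℂ} (h : IsOrbitIn p q c Λ ζ) :
    IsOrbitIn p q c Λ (orbitShift ζ) :=
  ⟨fun n => h.1 (n + 1), fun n => h.2 (n + 1)⟩

theorem orbitShift_iterate (ζ : ℕ → ℂ) (m n : ℕ) : (orbitShift^[m] ζ) n = ζ (n + m) := by
  induction m generalizing n with
  | zero => rfl
  | succ m ih =>
    rw [Function.iterate_succ_apply']
    show (orbitShift^[m] ζ) (n + 1) = _
    rw [ih]; congr 1; ring

theorem IsOrbitIn.shift_iterate {p q : ℕ} {c : ℂ} {Λ : Set ℂ} {ζ : ℕ → ℂ}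
    (h : IsOrbitIn p q c Λ ζ) (m : ℕ) : IsOrbitIn p q c Λ (orbitShift^[m] ζ) := by
  induction m with
  | zero => exact h
  | succ m ih => rw [Function.iterate_succ_apply']; exact ih.shift

theorem continuous_orbitShift : Continuous orbitShift :=
  continuous_pi fun n => continuous_apply (n + 1)

theorem isCompact_orbitSet {p q : ℕ} {c : ℂ} {Λ : Set ℂ} (hΛ : IsCompact Λ) :
    IsCompact (orbitSet p q c Λ) := by
  refine (isCompact_univ_pi (fun _ : ℕ => hΛ)).of_isClosed_subset ?_ ?_
  · have : orbitSet p q c Λ = (⋂ n : ℕ, {ζ : ℕ → ℂ | ζ n ∈ Λ}) ∩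
        ⋂ n : ℕ, {ζ : ℕ → ℂ | (ζ (n + 1) - c) ^ q = ζ n ^ p} := by
      ext ζ; simp [orbitSet, IsOrbitIn, Corr]
    rw [this]
    refine (isClosed_iInter fun n => hΛ.isClosed.preimage (continuous_apply n)).inter
      (isClosed_iInter fun n => isClosed_eq ?_ ?_)
    · exact ((continuous_apply (n + 1)).sub continuous_const).pow q
    · exact (continuous_apply n).pow p
  · intro ζ hζ n _
    exact hζ.1 n

/-! ### The encoding series: convergence, recursion and continuity. -/

section Summation

variable {δ : ℝ} {ζ : ℕ → ℂ} {M : ℝ}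

theorem norm_encoding_term_le (hδ : 0 ≤ δ) (hM : ∀ n, ‖ζ (n + 1)‖ ≤ M) (k : ℕ) :
    ‖(δ : ℂ) ^ k * ζ (k + 1)‖ ≤ δ ^ k * M := by
  rw [norm_mul, norm_pow, Complex.norm_real, Real.norm_of_nonneg hδ]
  exact mul_le_mul_of_nonneg_left (hM k) (pow_nonneg hδ k)

theorem summable_encoding (hδ : 0 ≤ δ) (hδ' : δ < 1) (hM : ∀ n, ‖ζ (n + 1)‖ ≤ M) :
    Summable fun k : ℕ => (δ : ℂ) ^ k * ζ (k + 1) :=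
  Summable.of_norm_bounded ((summable_geometric_of_lt_one hδ hδ').mul_right M)
    (norm_encoding_term_le hδ hM)

theorem norm_tsum_encoding_le (hδ : 0 ≤ δ) (hδ' : δ < 1) (hM : ∀ n, ‖ζ (n + 1)‖ ≤ M) :
    ‖∑' k : ℕ, (δ : ℂ) ^ k * ζ (k + 1)‖ ≤ (1 - δ)⁻¹ * M :=
  tsum_of_norm_bounded ((hasSum_geometric_of_lt_one hδ hδ').mul_right M)
    (norm_encoding_term_le hδ hM)

theorem bundlePoint_snd (r : ℝ) (hδ : 0 ≤ δ) (hδ' : δ < 1) (hM : ∀ n, ‖ζ (n + 1)‖ ≤ M) :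
    (bundlePoint r δ ζ).2 = r * ζ 1 + δ * (bundlePoint r δ (orbitShift ζ)).2 := by
  simp only [bundlePoint]
  rw [(summable_encoding hδ hδ' hM).tsum_eq_zero_add]
  simp only [orbitShift, pow_succ', mul_assoc, tsum_mul_left]
  ring

theorem bundlePoint_snd_sub (r : ℝ) (hδ : 0 ≤ δ) (hδ' : δ < 1) (hM : ∀ n, ‖ζ (n + 1)‖ ≤ M)
    (n : ℕ) : (bundlePoint r δ ζ).2 = r * ∑ k ∈ Finset.range n, (δ : ℂ) ^ k * ζ (k + 1) +
      δ ^ n * (bundlePoint r δ (orbitShift^[n] ζ)).2 := by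
  induction n with
  | zero => simp
  | succ n ih =>
    rw [ih, bundlePoint_snd r hδ hδ' (ζ := orbitShift^[n] ζ) (M := M)
      (fun m => by rw [orbitShift_iterate, add_right_comm]; exact hM _),
      Finset.sum_range_succ, Function.iterate_succ_apply', orbitShift_iterate, add_comm 1 n]
    ring

theorem norm_bundlePoint_sub_le {r : ℝ} (hr : 0 ≤ r) (hδ : 0 ≤ δ) (hδ' : δ < 1) {ξ : ℕ → ℂ}
    {M' : ℝ} (hζ : ∀ n, ‖ζ (n + 1)‖ ≤ M') (hξ : ∀ n, ‖ξ (n + 1)‖ ≤ M')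
    (hM : ∀ n, ‖ζ n - ξ n‖ ≤ M) :
    ‖bundlePoint r δ ζ - bundlePoint r δ ξ‖ ≤ max M (r * ((1 - δ)⁻¹ * M)) := by
  refine max_le_max (hM 0) ?_
  simp only [bundlePoint, Prod.snd_sub]
  rw [← mul_sub, ← (summable_encoding hδ hδ' hζ).tsum_sub (summable_encoding hδ hδ' hξ),
    norm_mul, Complex.norm_real, Real.norm_of_nonneg hr]
  refine mul_le_mul_of_nonneg_left ?_ hr
  simp only [← mul_sub]
  exact norm_tsum_encoding_le (ζ := fun n => ζ n - ξ n) hδ hδ' fun n => hM (n + 1)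

theorem continuousOn_bundlePoint (r : ℝ) (hδ : 0 ≤ δ) (hδ' : δ < 1) {s : Set (ℕ → ℂ)}
    (hs : ∀ ζ ∈ s, ∀ n, ‖ζ (n + 1)‖ ≤ M) : ContinuousOn (bundlePoint r δ) s := by
  refine (continuous_apply 0).continuousOn.prodMk (continuousOn_const.mul ?_)
  refine continuousOn_tsum (fun k => ?_) ((summable_geometric_of_lt_one hδ hδ').mul_right M)
    fun k ζ hζ => norm_encoding_term_le hδ (hs ζ hζ) k
  exact (continuous_const.mul (continuous_apply (k + 1))).continuousOn

end Summation

/-! ### The Cantor bundle of an admissible set -/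

/-- Test the inclusion on the point of the small disk farthest from the origin, a + δ a/|a|, or δ
itself when a = 0. -/
theorem add_norm_le_of_closedBall_subset {a : ℂ} {δ : ℝ} (hδ : 0 ≤ δ)
    (h : Metric.closedBall a δ ⊆ Metric.closedBall 0 1) : ‖a‖ + δ ≤ 1 := by
  rcases eq_or_ne a 0 with rfl | ha
  · have : (δ : ℂ) ∈ Metric.closedBall (0 : ℂ) 1 := h (by simp [abs_of_nonneg hδ])
    simpa [abs_of_nonneg hδ] using this
  · have hn : (‖a‖ : ℂ) ≠ 0 := by simpa using ha
    have : a + δ * (a / ‖a‖) ∈ Metric.closedBall (0 : ℂ) 1 := h (by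
      simp [abs_of_nonneg hδ, ha])
    rw [mem_closedBall_zero_iff] at this
    have e : a + δ * (a / ‖a‖) = a * ((1 + δ / ‖a‖ : ℝ) : ℂ) := by push_cast; ring
    rw [e, norm_mul, Complex.norm_real, Real.norm_of_nonneg (by positivity)] at this
    have h3 : ‖a‖ * (1 + δ / ‖a‖) = ‖a‖ + δ := by
      have : ‖a‖ ≠ 0 := by simpa using ha
      field_simp
    linarith

section Admissible

variable {p q : ℕ} {c : ℂ} {Λ : Set ℂ} {r δ : ℝ}

theorem Admissible.norm_le (h : Admissible p q c Λ r δ) {z w : ℂ} (hz : z ∈ Λ) (hw : w ∈ Λ)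
    (hzw : Corr p q c z w) : r * ‖w‖ + δ ≤ 1 := by
  have := add_norm_le_of_closedBall_subset h.2.2.2.1.le (h.2.2.2.2 z hz w hw hzw).1
  rwa [norm_mul, Complex.norm_real, Real.norm_of_nonneg h.1.le] at this

theorem Admissible.lt_norm (h : Admissible p q c Λ r δ) {z : ℂ} (hz : z ∈ Λ) : r < ‖z‖ :=
  (h.2.2.1.2.2 z hz).1.1

theorem Admissible.delta_lt_one (h : Admissible p q c Λ r δ) {ζ : ℕ → ℂ}
    (hζ : IsOrbitIn p q c Λ ζ) : δ < 1 := by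
  have h1 := h.norm_le (hζ.1 0) (hζ.1 1) (hζ.2 0)
  have h2 : 0 < r * ‖ζ 1‖ := mul_pos h.1 (h.1.trans (h.lt_norm (hζ.1 1)))
  linarith

theorem Admissible.norm_orbit_le (h : Admissible p q c Λ r δ) {ζ : ℕ → ℂ}
    (hζ : IsOrbitIn p q c Λ ζ) (n : ℕ) : ‖ζ (n + 1)‖ ≤ (1 - δ) / r := by
  have h1 := h.norm_le (hζ.1 n) (hζ.1 (n + 1)) (hζ.2 n)
  rw [le_div_iff₀ h.1]
  linarith

/-- The bound |ζ_{n+1}| ≤ (1 - δ)/r is exactly what cancels the geometric sum. Applied to the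
shifted orbit, it places the second coordinate of an encoded orbit in the disk of radius δ about r
ζ₁. -/
theorem Admissible.norm_bundlePoint_snd_le (h : Admissible p q c Λ r δ) {ζ : ℕ → ℂ}
    (hζ : IsOrbitIn p q c Λ ζ) : ‖(bundlePoint r δ ζ).2‖ ≤ 1 := by
  have hδ := h.delta_lt_one hζ
  have h1 := norm_tsum_encoding_le h.2.2.2.1.le hδ (h.norm_orbit_le hζ)
  simp only [bundlePoint]
  rw [norm_mul, Complex.norm_real, Real.norm_of_nonneg h.1.le]
  have h2 : (1 - δ)⁻¹ * ((1 - δ) / r) = r⁻¹ := by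
    have : 1 - δ ≠ 0 := by linarith
    have := h.1.ne'
    field_simp
  rw [h2] at h1
  calc _ ≤ r * r⁻¹ := mul_le_mul_of_nonneg_left h1 h.1.le
    _ = 1 := mul_inv_cancel₀ h.1.ne'

theorem Admissible.snd_bundlePoint (h : Admissible p q c Λ r δ) {ζ : ℕ → ℂ}
    (hζ : IsOrbitIn p q c Λ ζ) :
    (bundlePoint r δ ζ).2 = r * ζ 1 + δ * (bundlePoint r δ (orbitShift ζ)).2 :=
  bundlePoint_snd r h.2.2.2.1.le (h.delta_lt_one hζ) (h.norm_orbit_le hζ)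

theorem Admissible.continuousOn_bundlePoint (h : Admissible p q c Λ r δ) :
    ContinuousOn (bundlePoint r δ) (orbitSet p q c Λ) := by
  rcases (orbitSet p q c Λ).eq_empty_or_nonempty with h0 | ⟨ζ, hζ⟩
  · rw [h0]; exact continuousOn_empty _
  · exact _root_.continuousOn_bundlePoint r h.2.2.2.1.le (h.delta_lt_one hζ)
      fun ξ hξ => h.norm_orbit_le hξ

/-- Disjointness of the δ-disks over a common ζ₀ determines ζ₁; subtracting r ζ₁ and dividing by δ
leaves the encoding of the shifted orbit, and the argument repeats. -/
theorem Admissible.injOn_bundlePoint (h : Admissible p q c Λ r δ) :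
    InjOn (bundlePoint r δ) (orbitSet p q c Λ) := by
  have key : ∀ ζ ξ : ℕ → ℂ, IsOrbitIn p q c Λ ζ → IsOrbitIn p q c Λ ξ →
      bundlePoint r δ ζ = bundlePoint r δ ξ →
      bundlePoint r δ (orbitShift ζ) = bundlePoint r δ (orbitShift ξ) := by
    intro ζ ξ hζ hξ e
    have e0 : ζ 0 = ξ 0 := congrArg Prod.fst e
    have e2 : (bundlePoint r δ ζ).2 = (bundlePoint r δ ξ).2 := congrArg Prod.snd e
    have mem : ∀ χ : ℕ → ℂ, IsOrbitIn p q c Λ χ →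
        (bundlePoint r δ χ).2 ∈ Metric.closedBall ((r : ℂ) * χ 1) δ := by
      intro χ hχ
      rw [h.snd_bundlePoint hχ, mem_closedBall_iff_norm, add_sub_cancel_left, norm_mul,
        Complex.norm_real, Real.norm_of_nonneg h.2.2.2.1.le]
      exact mul_le_of_le_one_right h.2.2.2.1.le (h.norm_bundlePoint_snd_le hχ.shift)
    have e1 : ζ 1 = ξ 1 := by
      by_contra hne
      have hd := (h.2.2.2.2 (ζ 0) (hζ.1 0) (ζ 1) (hζ.1 1) (hζ.2 0)).2 (ξ 1) (hξ.1 1)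
        (e0 ▸ hξ.2 0) (Ne.symm hne)
      exact Set.disjoint_left.1 hd (mem ζ hζ) (e2 ▸ mem ξ hξ)
    refine Prod.ext e1 ?_
    rw [h.snd_bundlePoint hζ, h.snd_bundlePoint hξ, e1] at e2
    exact mul_left_cancel₀ (Complex.ofReal_ne_zero.2 h.2.2.2.1.ne') (add_left_cancel e2)
  intro ζ hζ ξ hξ e
  have all : ∀ n, bundlePoint r δ (orbitShift^[n] ζ) = bundlePoint r δ (orbitShift^[n] ξ) := by
    intro n
    induction n with
    | zero => exact e
    | succ n ih =>
      rw [Function.iterate_succ_apply', Function.iterate_succ_apply']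
      exact key _ _ (hζ.shift_iterate n) (hξ.shift_iterate n) ih
  funext n
  have := congrArg Prod.fst (all n)
  simpa [bundlePoint, orbitShift_iterate] using this

/-- The bundle consists of the points that encode the forward orbits. -/
theorem Admissible.cantorBundle_eq (h : Admissible p q c Λ r δ) :
    cantorBundle p q c Λ r δ = bundlePoint r δ '' orbitSet p q c Λ := by
  have hδ0 := h.2.2.2.1
  have near : ∀ ζ, IsOrbitIn p q c Λ ζ → ∀ n : ℕ, dist (bundlePoint r δ ζ).2
      ((r : ℂ) * ∑ k ∈ Finset.range n, (δ : ℂ) ^ k * ζ (k + 1)) ≤ δ ^ n := by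
    intro ζ hζ n
    rw [bundlePoint_snd_sub r hδ0.le (h.delta_lt_one hζ) (h.norm_orbit_le hζ) n, dist_eq_norm,
      add_sub_cancel_left, norm_mul, norm_pow, Complex.norm_real, Real.norm_of_nonneg hδ0.le]
    exact mul_le_of_le_one_right (by positivity)
      (h.norm_bundlePoint_snd_le (hζ.shift_iterate n))
  apply Subset.antisymm
  · rintro ⟨z, w⟩ ⟨hz, hw⟩
    have hw' : ∀ n : ℕ, ∃ ζ : ℕ → ℂ, (IsOrbitIn p q c Λ ζ ∧ ζ 0 = z) ∧ dist w
        ((r : ℂ) * ∑ k ∈ Finset.range (n + 1), (δ : ℂ) ^ k * ζ (k + 1)) ≤ δ ^ (n + 1) := by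
      intro n
      have := mem_iInter₂.1 hw (n + 1) (Nat.succ_pos n)
      simpa only [diskLevel, mem_iUnion, exists_prop, mem_ofPred_eq, Metric.mem_closedBall] using this
    choose ζ hζ hd using hw'
    have hδ1 := h.delta_lt_one (hζ 0).1
    -- The orbits chosen at different levels need not be related. Their encodings nevertheless
    -- converge to (z, w), and the set of encodings is compact.
    have hcl : IsClosed (bundlePoint r δ '' orbitSet p q c Λ) :=
      ((isCompact_orbitSet h.2.2.1.1).image_of_continuousOn h.continuousOn_bundlePoint).isClosed
    have hlim : Tendsto (fun n => bundlePoint r δ (ζ n)) atTop (𝓝 (z, w)) := by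
      refine Tendsto.prodMk_nhds ?_ ?_
      · simp only [(hζ _).2]; exact tendsto_const_nhds
      · refine tendsto_iff_dist_tendsto_zero.2 ?_
        have h0 : Tendsto (fun n : ℕ => δ ^ (n + 1) + δ ^ (n + 1)) atTop (𝓝 0) := by
          have := (tendsto_pow_atTop_nhds_zero_of_lt_one hδ0.le hδ1).comp (tendsto_add_atTop_nat 1)
          simpa using this.add this
        refine squeeze_zero (fun _ => dist_nonneg) (fun n => ?_) h0
        refine (dist_triangle_right _ _ ((r : ℂ) * ∑ k ∈ Finset.range (n + 1),
          (δ : ℂ) ^ k * ζ n (k + 1))).trans (add_le_add (near _ (hζ n).1 _) (hd n))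
    exact hcl.mem_of_tendsto hlim (Eventually.of_forall fun n => ⟨ζ n, (hζ n).1, rfl⟩)
  · rintro _ ⟨ζ, hζ, rfl⟩
    refine ⟨hζ.1 0, mem_iInter₂.2 fun n _ => ?_⟩
    exact mem_iUnion₂.2 ⟨ζ, ⟨hζ, rfl⟩, near ζ hζ n⟩

theorem Admissible.isCompact_cantorBundle (h : Admissible p q c Λ r δ) :
    IsCompact (cantorBundle p q c Λ r δ) := by
  rw [h.cantorBundle_eq]
  exact (isCompact_orbitSet h.2.2.1.1).image_of_continuousOn h.continuousOn_bundlePoint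

end Admissible

/-! ### Branches of the correspondence -/

/-- The branch of the correspondence near `a` that takes `a` to `b`. -/
noncomputable def corrBranch (p q : ℕ) (c a b z : ℂ) : ℂ :=
  c + (b - c) * Complex.exp ((p / q : ℂ) * Complex.log (z / a))

section Branch

variable {p q : ℕ} {c a b : ℂ}

theorem corrBranch_self (ha : a ≠ 0) : corrBranch p q c a b a = b := by
  simp [corrBranch, div_self ha]

theorem corr_corrBranch (hq : q ≠ 0) (ha : a ≠ 0) (hab : Corr p q c a b) {z : ℂ} (hz : z ≠ 0) :
    Corr p q c z (corrBranch p q c a b z) := by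
  have hq' : (q : ℂ) ≠ 0 := Nat.cast_ne_zero.2 hq
  unfold Corr at *
  rw [corrBranch, add_sub_cancel_left, mul_pow, hab, ← Complex.exp_nat_mul]
  have : (q : ℂ) * ((p / q : ℂ) * Complex.log (z / a)) = p * Complex.log (z / a) := by
    field_simp
  rw [this, Complex.exp_nat_mul, Complex.exp_log (div_ne_zero hz ha), ← mul_pow,
    mul_div_cancel₀ _ ha]

theorem div_mem_slitPlane {z : ℂ} (hz : z ∈ Metric.ball a ‖a‖) :
    z / a ∈ Complex.slitPlane := by
  rw [mem_ball_iff_norm] at hz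
  have ha : a ≠ 0 := by rintro rfl; simp at hz; exact absurd hz (norm_nonneg z).not_gt
  have h1 : ‖z / a - 1‖ < 1 := by
    rw [div_sub_one ha, norm_div, div_lt_one (norm_pos_iff.2 ha)]; exact hz
  left
  have h2 := (Complex.abs_re_le_norm (z / a - 1)).trans_lt h1
  have := (abs_lt.1 h2).1
  simp only [Complex.sub_re, Complex.one_re] at this
  linarith

theorem analyticAt_corrBranch {z : ℂ} (hz : z ∈ Metric.ball a ‖a‖) :
    AnalyticAt ℂ (corrBranch p q c a b) z := by
  have h1 : AnalyticAt ℂ (fun z : ℂ => z / a) z := analyticAt_id.div_const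
  exact analyticAt_const.add (analyticAt_const.mul
    (analyticAt_const.mul (h1.clog (div_mem_slitPlane hz))).cexp)

theorem isBranchAt_corrBranch (hq : q ≠ 0) (ha : a ≠ 0) (hab : Corr p q c a b) :
    IsBranchAt p q c (corrBranch p q c a b) a := by
  refine ⟨analyticAt_corrBranch (Metric.mem_ball_self (norm_pos_iff.2 ha)), ?_⟩
  filter_upwards [isOpen_ne.mem_nhds ha] with x hx
  exact corr_corrBranch hq ha hab hx

/-- The logarithmic derivatives of a branch: `φ' · z · q = p · (φ - c)`. -/
theorem IsBranchAt.deriv_eq {φ : ℂ → ℂ} {z : ℂ} (hq : q ≠ 0) (hp : p ≠ 0) (h : IsBranchAt p q c φ z)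
    (hz : z ≠ 0) : deriv φ z = (p / q : ℂ) * ((φ z - c) / z) := by
  obtain ⟨q, rfl⟩ := Nat.exists_eq_succ_of_ne_zero hq
  obtain ⟨p, rfl⟩ := Nat.exists_eq_succ_of_ne_zero hp
  have hd : HasDerivAt φ (deriv φ z) z := h.1.differentiableAt.hasDerivAt
  have h1 : HasDerivAt (fun x => (φ x - c) ^ (q + 1)) _ z := (hd.sub_const c).pow (q + 1)
  have h2 : HasDerivAt (fun x : ℂ => x ^ (p + 1)) _ z := hasDerivAt_pow (p + 1) z
  have h3 := h1.unique (h2.congr_of_eventuallyEq h.2)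
  have hc : (φ z - c) ^ (q + 1) = z ^ (p + 1) := h.2.self_of_nhds
  have hne : φ z - c ≠ 0 := by
    intro h0
    rw [h0, zero_pow (Nat.succ_ne_zero q)] at hc
    exact pow_ne_zero _ hz hc.symm
  have hq' : ((q + 1 : ℕ) : ℂ) ≠ 0 := Nat.cast_ne_zero.2 hq
  simp only [Nat.add_sub_cancel, Nat.succ_eq_add_one] at h3 ⊢
  rw [div_mul_div_comm, eq_div_iff (mul_ne_zero hq' hz)]
  -- Here `q` and `p` are the predecessors of the original exponents, so this power is the one
  -- produced by differentiating (φ - c)^(q+1) = z^(p+1).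
  apply mul_left_cancel₀ (pow_ne_zero q hne)
  calc (φ z - c) ^ q * (deriv φ z * (((q + 1 : ℕ) : ℂ) * z))
      = (((q + 1 : ℕ) : ℂ) * (φ z - c) ^ q * deriv φ z) * z := by ring
    _ = ((p + 1 : ℕ) : ℂ) * z ^ (p + 1) := by rw [h3]; ring
    _ = _ := by rw [← hc]; ring

theorem finite_roots_of_unity {q : ℕ} (hq : q ≠ 0) : {ω : ℂ | ω ^ q = 1}.Finite :=
  (Multiset.finite_toSet (Polynomial.nthRoots q (1 : ℂ))).subset fun _ hω =>
    (Polynomial.mem_nthRoots (Nat.pos_of_ne_zero hq)).2 hω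

/-- By homogeneity it suffices that 1 is isolated among the finitely many q-th roots of unity. -/
theorem exists_root_separation {q : ℕ} (hq : q ≠ 0) :
    ∃ κ : ℝ, 0 < κ ∧ ∀ u v : ℂ, u ^ q = v ^ q → u ≠ v → κ * ‖u‖ ≤ ‖u - v‖ := by
  have hfin : {ω : ℂ | ω ^ q = 1 ∧ ω ≠ 1}.Finite :=
    (finite_roots_of_unity hq).subset fun ω hω => hω.1
  have hn : {ω : ℂ | ω ^ q = 1 ∧ ω ≠ 1}ᶜ ∈ 𝓝 (1 : ℂ) :=
    hfin.isClosed.isOpen_compl.mem_nhds (by simp)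
  obtain ⟨κ, hκ, hb⟩ := Metric.mem_nhds_iff.1 hn
  refine ⟨κ, hκ, fun u v huv hne => ?_⟩
  rcases eq_or_ne u 0 with rfl | hu
  · simp
  have h1 : v / u ∉ Metric.ball (1 : ℂ) κ := by
    intro hm
    refine hb hm ⟨?_, ?_⟩
    · rw [div_pow, ← huv, div_self (pow_ne_zero q hu)]
    · intro h; exact hne ((div_eq_one_iff_eq hu).1 h).symm
  rw [mem_ball_iff_norm, not_lt, div_sub_one hu, norm_div, le_div_iff₀ (norm_pos_iff.2 hu)] at h1
  rwa [norm_sub_rev]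

end Branch

/-! ### The bundle map -/

section BundleMap

variable {p q : ℕ} {c : ℂ} {Λ : Set ℂ} {r δ η : ℝ} {f : ℂ × ℂ → ℂ × ℂ}

theorem IsBundleMap.mono {η' : ℝ} (h : IsBundleMap p q c Λ r δ η f) (hη' : 0 < η')
    (hle : η' ≤ η) : IsBundleMap p q c Λ r δ η' f := by
  refine ⟨hη', fun ζ hζ => ?_⟩
  obtain ⟨φ, h1, h2, h3, h4⟩ := h.2 ζ hζ
  exact ⟨φ, h1.mono (Metric.ball_subset_ball hle),
    fun z hz => h2 z (Metric.ball_subset_ball hle hz), h3,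
    fun x hx => h4 x (Metric.ball_subset_ball hle hx)⟩

theorem IsBundleMap.apply_bundlePoint (h : IsBundleMap p q c Λ r δ η f)
    (hA : Admissible p q c Λ r δ) {ζ : ℕ → ℂ} (hζ : IsOrbitIn p q c Λ ζ) :
    f (bundlePoint r δ ζ) = bundlePoint r δ (orbitShift ζ) := by
  obtain ⟨φ, -, -, h3, h4⟩ := h.2 ζ hζ
  rw [h4 _ (Metric.mem_ball_self h.1)]
  have h5 : φ (bundlePoint r δ ζ).1 = ζ 1 := h3
  rw [h5]
  refine Prod.ext rfl ?_
  have hδ : (δ : ℂ) ≠ 0 := Complex.ofReal_ne_zero.2 hA.2.2.2.1.ne'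
  show (δ : ℂ)⁻¹ * (bundlePoint r δ ζ).2 - r * (δ : ℂ)⁻¹ * ζ 1 = _
  rw [hA.snd_bundlePoint hζ]
  field_simp
  ring

theorem IsBundleMap.iterate_bundlePoint (h : IsBundleMap p q c Λ r δ η f)
    (hA : Admissible p q c Λ r δ) {ζ : ℕ → ℂ} (hζ : IsOrbitIn p q c Λ ζ) (n : ℕ) :
    f^[n] (bundlePoint r δ ζ) = bundlePoint r δ (orbitShift^[n] ζ) := by
  induction n with
  | zero => rfl
  | succ n ih =>
    rw [Function.iterate_succ_apply', Function.iterate_succ_apply', ih,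
      h.apply_bundlePoint hA (hζ.shift_iterate n)]

/-- Close to each other, points of the bundle have the same branches. -/
theorem Admissible.exists_coherent_radius (hq : q ≠ 0) (hA : Admissible p q c Λ r δ) :
    ∃ η : ℝ, 0 < η ∧ η ≤ r ∧ ∀ ζ ξ : ℕ → ℂ, IsOrbitIn p q c Λ ζ → IsOrbitIn p q c Λ ξ →
      ∀ x, x ∈ Metric.ball (bundlePoint r δ ζ) η → x ∈ Metric.ball (bundlePoint r δ ξ) η →
        corrBranch p q c (ζ 0) (ζ 1) x.1 = corrBranch p q c (ξ 0) (ξ 1) x.1 := by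
  obtain ⟨κ, hκ, hsep⟩ := exists_root_separation hq
  -- Compactness: bad pairs of orbits at radii r/(n+1) subconverge. The radii stay at most r so that
  -- x.1 cannot be 0.
  by_contra! hcon
  have hpos : ∀ n : ℕ, 0 < r / (n + 1 : ℝ) := fun n => div_pos hA.1 (by positivity)
  have hle : ∀ n : ℕ, r / (n + 1 : ℝ) ≤ r := fun n =>
    div_le_self hA.1.le (by linarith [(Nat.cast_nonneg n : (0 : ℝ) ≤ n)])
  choose ζ ξ hζ hξ x hxζ hxξ hne using fun n : ℕ => hcon (r / (n + 1 : ℝ)) (hpos n) (hle n)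
  have hK := isCompact_orbitSet (p := p) (q := q) (c := c) hA.2.2.1.1
  obtain ⟨⟨ζ', ξ'⟩, ⟨hζ', hξ'⟩, φ, hφ, hlim⟩ :=
    (hK.prod hK).tendsto_subseq (x := fun n => (ζ n, ξ n)) fun n => ⟨hζ n, hξ n⟩
  have hlζ : Tendsto (fun n => ζ (φ n)) atTop (𝓝 ζ') := (continuous_fst.tendsto _).comp hlim
  have hlξ : Tendsto (fun n => ξ (φ n)) atTop (𝓝 ξ') := (continuous_snd.tendsto _).comp hlim
  have hrad : Tendsto (fun n => r / ((φ n : ℕ) + 1 : ℝ)) atTop (𝓝 0) := by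
    have := (tendsto_one_div_add_atTop_nhds_zero_nat (𝕜 := ℝ)).const_mul r
    simp only [mul_zero, mul_one_div] at this
    exact this.comp hφ.tendsto_atTop
  have hbp : ∀ (χ : ℕ → ℕ → ℂ) (χ' : ℕ → ℂ), (∀ n, IsOrbitIn p q c Λ (χ n)) →
      IsOrbitIn p q c Λ χ' → Tendsto (fun n => χ (φ n)) atTop (𝓝 χ') →
      (∀ n, x n ∈ Metric.ball (bundlePoint r δ (χ n)) (r / (n + 1 : ℝ))) →
      Tendsto (fun n => x (φ n)) atTop (𝓝 (bundlePoint r δ χ')) := by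
    intro χ χ' hχ hχ' hl hx
    have h1 : Tendsto (fun n => bundlePoint r δ (χ (φ n))) atTop (𝓝 (bundlePoint r δ χ')) :=
      (hA.continuousOn_bundlePoint χ' hχ').tendsto.comp
        (tendsto_nhdsWithin_iff.2 ⟨hl, Eventually.of_forall fun n => hχ _⟩)
    refine h1.congr_dist (squeeze_zero (fun _ => dist_nonneg) (fun n => ?_) hrad)
    rw [dist_comm]
    exact (Metric.mem_ball.1 (hx (φ n))).le
  have hx1 := hbp ζ ζ' hζ hζ' hlζ hxζ
  have hx2 := hbp ξ ξ' hξ hξ' hlξ hxξ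
  -- Both encodings converge to the limit of the same points x, so the limit orbits coincide and
  -- both branches tend to ζ'₁.
  have e : ζ' = ξ' := hA.injOn_bundlePoint hζ' hξ' (tendsto_nhds_unique hx1 hx2)
  subst e
  have hz0 : ζ' 0 ≠ 0 := norm_pos_iff.1 (hA.1.trans (hA.lt_norm (hζ'.1 0)))
  have hbr : ∀ (χ : ℕ → ℕ → ℂ), Tendsto (fun n => χ (φ n)) atTop (𝓝 ζ') →
      Tendsto (fun n => corrBranch p q c (χ (φ n) 0) (χ (φ n) 1) (x (φ n)).1) atTop
        (𝓝 (ζ' 1)) := by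
    intro χ hl
    have h0 := ((continuous_apply 0).tendsto ζ').comp hl
    have h1 := ((continuous_apply 1).tendsto ζ').comp hl
    have h2 : Tendsto (fun n => (x (φ n)).1) atTop (𝓝 (ζ' 0)) :=
      (continuous_fst.tendsto _).comp hx1
    have h3 : Tendsto (fun n => (x (φ n)).1 / χ (φ n) 0) atTop (𝓝 1) := by
      have := h2.div h0 hz0
      rwa [div_self hz0] at this
    have h4 := (Complex.continuous_exp.tendsto _).comp
      ((h3.clog (Or.inl (by simp))).const_mul (p / q : ℂ))
    have h5 := ((h1.sub_const c).mul h4).const_add c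
    simpa [corrBranch] using h5
  have hb1 := hbr ζ hlζ
  have hb2 := hbr ξ hlξ
  have hx0 : ∀ n, (x n).1 ≠ 0 := by
    intro n h0
    have h1 : dist (x n).1 (ζ n 0) ≤ dist (x n) (bundlePoint r δ (ζ n)) := le_max_left _ _
    have h2 := (Metric.mem_ball.1 (hxζ n)).trans_le (hle n)
    rw [h0, dist_zero_left] at h1
    exact absurd (h1.trans_lt h2) (hA.lt_norm ((hζ n).1 0)).not_gt
  -- Distinct branch values at one point differ by at least κ |branch - c|, which tends to κ |ζ'₁ -
  -- c| > 0, while their difference tends to 0.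
  have hineq : ∀ n, κ * ‖corrBranch p q c (ζ (φ n) 0) (ζ (φ n) 1) (x (φ n)).1 - c‖ ≤
      ‖(corrBranch p q c (ζ (φ n) 0) (ζ (φ n) 1) (x (φ n)).1 - c) -
        (corrBranch p q c (ξ (φ n) 0) (ξ (φ n) 1) (x (φ n)).1 - c)‖ := by
    intro n
    refine hsep _ _ ?_ fun h => hne (φ n) (sub_left_injective h)
    have g1 := corr_corrBranch hq
      (norm_pos_iff.1 (hA.1.trans (hA.lt_norm ((hζ (φ n)).1 0)))) ((hζ (φ n)).2 0) (hx0 (φ n))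
    have g2 := corr_corrBranch hq
      (norm_pos_iff.1 (hA.1.trans (hA.lt_norm ((hξ (φ n)).1 0)))) ((hξ (φ n)).2 0) (hx0 (φ n))
    exact g1.trans g2.symm
  have hfin := le_of_tendsto_of_tendsto' ((hb1.sub_const c).norm.const_mul κ)
    (((hb1.sub_const c).sub (hb2.sub_const c)).norm) hineq
  rw [sub_self, norm_zero] at hfin
  have h6 : r < ‖ζ' 1 - c‖ := (hA.2.2.1.2.2 (ζ' 1) (hζ'.1 1)).2.1
  exact absurd hfin (mul_pos hκ (hA.1.trans h6)).not_ge

theorem Admissible.exists_isBundleMap (hq : q ≠ 0) (hA : Admissible p q c Λ r δ) :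
    ∃ η f, IsBundleMap p q c Λ r δ η f := by
  classical
  obtain ⟨η, hη, hηr, hco⟩ := hA.exists_coherent_radius hq
  let F : (ℕ → ℂ) → ℂ × ℂ → ℂ × ℂ := fun ζ x => (corrBranch p q c (ζ 0) (ζ 1) x.1,
    (δ : ℂ)⁻¹ * x.2 - (r : ℂ) * (δ : ℂ)⁻¹ * corrBranch p q c (ζ 0) (ζ 1) x.1)
  -- Any orbit whose encoding is η-close to x may define the value; the coherent radius makes the
  -- choice immaterial.
  let f : ℂ × ℂ → ℂ × ℂ := fun x =>
    if h : ∃ ζ, IsOrbitIn p q c Λ ζ ∧ x ∈ Metric.ball (bundlePoint r δ ζ) η then F h.choose x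
    else x
  refine ⟨η, f, hη, fun ζ hζ => ?_⟩
  have hn := hA.lt_norm (hζ.1 0)
  have h0 : ζ 0 ≠ 0 := norm_pos_iff.1 (hA.1.trans hn)
  have hsub : Metric.ball (ζ 0) η ⊆ Metric.ball (ζ 0) ‖ζ 0‖ :=
    Metric.ball_subset_ball (hηr.trans hn.le)
  refine ⟨corrBranch p q c (ζ 0) (ζ 1), fun z hz => ?_, fun z hz => ?_, corrBranch_self h0,
    fun x hx => ?_⟩
  · exact (analyticAt_corrBranch (hsub hz)).differentiableAt.differentiableWithinAt
  · refine corr_corrBranch hq h0 (hζ.2 0) ?_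
    rintro rfl
    simpa using hsub hz
  · have hex : ∃ ζ, IsOrbitIn p q c Λ ζ ∧ x ∈ Metric.ball (bundlePoint r δ ζ) η := ⟨ζ, hζ, hx⟩
    have hf : f x = F hex.choose x := dif_pos hex
    refine hf.trans ?_
    have := hco _ ζ hex.choose_spec.1 hζ x hex.choose_spec.2 hx
    simp only [F, this]

end BundleMap

/-! ### Orbits on the unit circle and the solenoid -/

section CoprimePowers

variable {G : Type*} [CommGroup G] {a b : ℕ}

/-- With Bézout coefficients a s + b t = 1, the element x^s y^t works. -/
theorem exists_pow_eq_and_pow_eq (hab : a.Coprime b) {x y : G} (h : x ^ b = y ^ a) :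
    ∃ v : G, v ^ a = x ∧ v ^ b = y := by
  have hbez : (a : ℤ) * a.gcdA b + b * a.gcdB b = 1 := by
    rw [← Nat.gcd_eq_gcd_ab, hab.gcd_eq_one, Nat.cast_one]
  have h' : x ^ (b : ℤ) = y ^ (a : ℤ) := by simpa using h
  refine ⟨x ^ a.gcdA b * y ^ a.gcdB b, ?_, ?_⟩
  · rw [← zpow_natCast, mul_zpow, ← zpow_mul, ← zpow_mul, mul_comm (a.gcdB b), zpow_mul y, ← h',
      ← zpow_mul, ← zpow_add, mul_comm (a.gcdA b), hbez, zpow_one]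
  · rw [← zpow_natCast, mul_zpow, ← zpow_mul, ← zpow_mul, mul_comm (a.gcdA b), zpow_mul x, h',
      ← zpow_mul, ← zpow_add, mul_comm (a.gcdB b), hbez, zpow_one]

theorem eq_of_pow_eq_of_pow_eq (hab : a.Coprime b) {v w : G} (ha : v ^ a = w ^ a)
    (hb : v ^ b = w ^ b) : v = w := by
  have h : (v / w) ^ a.gcd b = 1 :=
    pow_gcd_eq_one.2 ⟨by rw [div_pow, ha, div_self'], by rw [div_pow, hb, div_self']⟩
  rwa [hab.gcd_eq_one, pow_one, div_eq_one] at h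

end CoprimePowers

section Circle

variable {p q : ℕ}

/-- The forward orbits of the unperturbed correspondence on the unit circle. -/
abbrev circleOrbits (p q : ℕ) : Set (ℕ → ℂ) := orbitSet p q 0 (Metric.sphere 0 1)

theorem continuous_circle_coe : Continuous fun u : Circle => (u : ℂ) := by fun_prop

theorem corr_zero_iff {z w : ℂ} : Corr p q 0 z w ↔ w ^ q = z ^ p := by
  rw [Corr, sub_zero]

/-- The orbit `u_n ^ (p ^ n)` that corresponds to a point `u` of the solenoid. -/
def solenoidOrbit (p q : ℕ) (u : Solenoid q) : ℕ → ℂ := fun n => (u.1 n : ℂ) ^ p ^ n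

theorem solenoidOrbit_mem (u : Solenoid q) : solenoidOrbit p q u ∈ circleOrbits p q := by
  refine ⟨fun n => by simp [solenoidOrbit, Circle.norm_coe], fun n => corr_zero_iff.2 ?_⟩
  simp only [solenoidOrbit]
  rw [← pow_mul, mul_comm, pow_mul, ← Circle.coe_pow, u.2 n, ← pow_mul, pow_succ]

theorem continuous_solenoidOrbit : Continuous (solenoidOrbit p q) :=
  continuous_pi fun n =>
    (continuous_circle_coe.comp ((continuous_apply n).comp continuous_subtype_val)).pow _

/-- The orbit gives the p^(n+1)-th power of u_{n+1}, and u_n is its q-th power; coprime powers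
determine an element. -/
theorem solenoidOrbit_injective (hpq : p.Coprime q) : Function.Injective (solenoidOrbit p q) := by
  intro u v huv
  apply Subtype.ext
  funext n
  have hpow : ∀ n, u.1 n ^ p ^ n = v.1 n ^ p ^ n := by
    intro n
    apply Subtype.ext
    simpa [solenoidOrbit] using congrFun huv n
  induction n with
  | zero => simpa using hpow 0
  | succ n ih =>
    refine eq_of_pow_eq_of_pow_eq (Nat.Coprime.pow_right (n + 1) hpq.symm) ?_ (hpow (n + 1))
    rw [u.2 n, v.2 n, ih]

/-- The coordinates u_n are built recursively. A common solution of v^q = u_n and v^(p^(n+1)) =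
ζ_{n+1} exists because ζ_{n+1}^q = ζ_n^p = u_n^(p^(n+1)). -/
theorem exists_solenoidOrbit_eq (hpq : p.Coprime q) {ζ : ℕ → ℂ} (hζ : ζ ∈ circleOrbits p q) :
    ∃ u : Solenoid q, solenoidOrbit p q u = ζ := by
  let Z : ℕ → Circle := fun n => ⟨ζ n, mem_sphere_zero_iff_norm.2 (by simpa using hζ.1 n)⟩
  have hZ : ∀ n, Z (n + 1) ^ q = Z n ^ p := fun n =>
    by
    apply Circle.ext
    rw [Circle.coe_pow, Circle.coe_pow]
    exact corr_zero_iff.1 (hζ.2 n)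
  have step : ∀ n (u : Circle), u ^ p ^ n = Z n →
      ∃ v : Circle, v ^ q = u ∧ v ^ p ^ (n + 1) = Z (n + 1) := by
    intro n u hu
    refine exists_pow_eq_and_pow_eq (Nat.Coprime.pow_right (n + 1) hpq.symm) ?_
    rw [hZ n, ← hu, ← pow_mul, pow_succ]
  choose v hv1 hv2 using step
  let s : ∀ n, {u : Circle // u ^ p ^ n = Z n} := fun n =>
    Nat.rec ⟨Z 0, by simp⟩ (fun n u => ⟨v n u.1 u.2, hv2 n u.1 u.2⟩) n
  refine ⟨⟨fun n => (s n).1, fun n => hv1 n (s n).1 (s n).2⟩, ?_⟩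
  funext n
  have := congrArg (fun x : Circle => (x : ℂ)) (s n).2
  simpa [solenoidOrbit, Z] using this

instance (q : ℕ) : CompactSpace (Solenoid q) := by
  refine isCompact_iff_compactSpace.1 (IsClosed.isCompact (X := ℕ → Circle) ?_)
  have : {ζ : ℕ → Circle | ∀ n, ζ (n + 1) ^ q = ζ n} =
      ⋂ n, {ζ : ℕ → Circle | ζ (n + 1) ^ q = ζ n} := by ext; simp
  show IsClosed {ζ : ℕ → Circle | ∀ n, ζ (n + 1) ^ q = ζ n}
  rw [this]
  exact isClosed_iInter fun n =>
    isClosed_eq ((continuous_apply (n + 1)).pow q) (continuous_apply n)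

theorem nonempty_homeomorph_solenoid (hpq : p.Coprime q) {r δ : ℝ}
    (hA : Admissible p q 0 (Metric.sphere 0 1) r δ) :
    Nonempty (cantorBundle p q 0 (Metric.sphere 0 1) r δ ≃ₜ Solenoid q) := by
  let g : Solenoid q → cantorBundle p q 0 (Metric.sphere 0 1) r δ := fun u =>
    ⟨bundlePoint r δ (solenoidOrbit p q u), by
      rw [hA.cantorBundle_eq]; exact mem_image_of_mem _ (solenoidOrbit_mem u)⟩
  have hg : Function.Bijective g := by
    constructor
    · intro u v huv
      exact solenoidOrbit_injective hpq (hA.injOn_bundlePoint (solenoidOrbit_mem u)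
        (solenoidOrbit_mem v) (congrArg Subtype.val huv))
    · rintro ⟨x, hx⟩
      have hx' := hx
      rw [hA.cantorBundle_eq] at hx'
      obtain ⟨ζ, hζ, rfl⟩ := hx'
      obtain ⟨u, rfl⟩ := exists_solenoidOrbit_eq hpq hζ
      exact ⟨u, rfl⟩
  have hc : Continuous g := (hA.continuousOn_bundlePoint.comp_continuous continuous_solenoidOrbit
    solenoidOrbit_mem).subtype_mk _
  exact ⟨(Continuous.homeoOfEquivCompactToT2 (f := Equiv.ofBijective g hg) hc).symm⟩

/-! ### Density of the periodic orbits -/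

theorem tendsto_pow_sub_pow_atTop (hqp : q < p) (hq : q ≠ 0) :
    Tendsto (fun m => p ^ m - q ^ m) atTop atTop := by
  have h : ∀ m, m ≤ p ^ m - q ^ m := by
    intro m
    have : m + q ^ m ≤ p ^ m := by
      induction m with
      | zero => simp
      | succ m ih =>
        have h1 : 1 ≤ q ^ m := Nat.one_le_pow _ _ (Nat.pos_of_ne_zero hq)
        calc m + 1 + q ^ (m + 1) ≤ (m + q ^ m) * (q + 1) := by
              rw [pow_succ]; nlinarith [Nat.zero_le (m * q)]
          _ ≤ p ^ m * p := Nat.mul_le_mul ih hqp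
          _ = p ^ (m + 1) := (pow_succ p m).symm
    omega
  exact tendsto_atTop_mono h tendsto_id

theorem exists_tendsto_root_of_unity (u : Circle) :
    ∃ v : ℕ → Circle, (∀ d, d ≠ 0 → v d ^ d = 1) ∧ Tendsto v atTop (𝓝 u) := by
  set θ : ℝ := Complex.arg u / (2 * Real.pi) with hθ
  have hu : Circle.exp (2 * Real.pi * θ) = u := by
    rw [hθ, mul_div_cancel₀ _ (by positivity), Circle.exp_arg]
  refine ⟨fun d => Circle.exp (2 * Real.pi * ((⌊θ * d⌋ : ℤ) / d : ℝ)), fun d hd => ?_, ?_⟩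
  · have hd' : (d : ℝ) ≠ 0 := Nat.cast_ne_zero.2 hd
    rw [← Circle.exp_natCast_mul]
    have : (d : ℝ) * (2 * Real.pi * ((⌊θ * d⌋ : ℤ) / d : ℝ)) = (⌊θ * d⌋ : ℤ) * (2 * Real.pi) := by
      field_simp
    rw [this, Circle.exp_int_mul_two_pi]
  · rw [← hu]
    refine (Circle.exp.continuous.tendsto _).comp (Tendsto.const_mul _ ?_)
    refine tendsto_of_tendsto_of_dist (f₁ := fun _ : ℕ => θ) tendsto_const_nhds ?_
    refine squeeze_zero' (Eventually.of_forall fun _ => dist_nonneg) ?_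
      (tendsto_one_div_atTop_nhds_zero_nat (𝕜 := ℝ))
    filter_upwards [eventually_gt_atTop 0] with d hd
    have hd' : (0 : ℝ) < d := Nat.cast_pos.2 hd
    have e : θ - (⌊θ * d⌋ : ℤ) / d = Int.fract (θ * d) / d := by
      rw [Int.fract]; field_simp
    rw [Real.dist_eq, e, abs_of_nonneg (div_nonneg (Int.fract_nonneg _) hd'.le)]
    exact div_le_div_of_nonneg_right (Int.fract_lt_one _).le hd'.le

/-- Near each orbit on the circle there is a periodic one. -/
theorem exists_periodic_near (hpq : p.Coprime q) (hqp : q < p) (hq : q ≠ 0) {ζ : ℕ → ℂ}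
    (hζ : ζ ∈ circleOrbits p q) (N : ℕ) {ε : ℝ} (hε : 0 < ε) :
    ∃ ξ ∈ circleOrbits p q, (∃ m, 1 ≤ m ∧ orbitShift^[m] ξ = ξ) ∧
      ∀ k ≤ N, ‖ξ k - ζ k‖ < ε := by
  obtain ⟨u, rfl⟩ := exists_solenoidOrbit_eq hpq hζ
  have hu : ∀ j k, u.1 (k + j) ^ q ^ j = u.1 k := by
    intro j k
    induction j with
    | zero => simp
    | succ j ih => rw [pow_succ', pow_mul, ← add_assoc, u.2, ih]
  -- The initial segment depends only on u_N, so moving u_N slightly moves all terms up to N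
  -- slightly.
  have hseg : ∀ k ≤ N, solenoidOrbit p q u k = (u.1 N : ℂ) ^ (p ^ k * q ^ (N - k)) := by
    intro k hk
    have := hu (N - k) k
    rw [Nat.add_sub_cancel' hk] at this
    rw [solenoidOrbit, ← this, mul_comm, pow_mul, Circle.coe_pow]
  have hev : ∀ᶠ v : Circle in 𝓝 (u.1 N), ∀ k ∈ Finset.range (N + 1),
      ‖(v : ℂ) ^ (p ^ k * q ^ (N - k)) - solenoidOrbit p q u k‖ < ε := by
    refine (Finset.eventually_all _).2 fun k hk => ?_
    have hc : Continuous fun v : Circle =>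
        ‖(v : ℂ) ^ (p ^ k * q ^ (N - k)) - solenoidOrbit p q u k‖ :=
      ((continuous_circle_coe.pow _).sub continuous_const).norm
    refine hc.continuousAt.eventually_lt continuousAt_const ?_
    rw [hseg k (Nat.lt_succ_iff.1 (Finset.mem_range.1 hk)), sub_self, norm_zero]
    exact hε
  obtain ⟨v, hv1, hv2⟩ := exists_tendsto_root_of_unity (u.1 N)
  have hd := tendsto_pow_sub_pow_atTop hqp hq
  obtain ⟨m, hm, hm1, hm0⟩ := ((hv2.comp hd).eventually hev |>.and
    ((eventually_ge_atTop 1).and (hd.eventually_gt_atTop 1))).exists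
  set d := p ^ m - q ^ m with hdef
  set w := v d with hw
  have hwd : w ^ d = 1 := hv1 d (by omega)
  have hle : q ^ m ≤ p ^ m := Nat.pow_le_pow_left hqp.le m
  have hcop : q.Coprime d := by
    have h1 : (q ^ m).Coprime d := by
      rw [hdef, Nat.coprime_sub_self_right hle]
      exact (Nat.Coprime.pow _ _ hpq).symm
    exact (Nat.coprime_pow_left_iff (by omega) _ _).1 h1
  obtain ⟨q', -, hq'⟩ := Nat.exists_mul_mod_eq_one_of_coprime hcop hm0
  replace hq' : q * q' ≡ 1 [MOD d] := hq'.trans (Nat.mod_eq_of_lt hm0).symm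
  have hmod : ∀ {i j : ℕ}, i ≡ j [MOD d] → w ^ i = w ^ j := by
    intro i j hij
    exact pow_eq_pow_iff_modEq.2 (hij.of_dvd (orderOf_dvd_of_pow_eq_one hwd))
  have hpqm : p ^ m ≡ q ^ m [MOD d] := ((Nat.modEq_iff_dvd' hle).2 dvd_rfl).symm
  have hqm : ∀ k, q' ^ k * q ^ k ≡ 1 [MOD d] := by
    intro k
    have := Nat.ModEq.pow k hq'
    rwa [one_pow, mul_comm, mul_pow] at this
  -- The exponent is (p/q)^k q^N modulo d: it makes sense for every k, has period m in k, and
  -- reduces to p^k q^(N-k) for k ≤ N.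
  refine ⟨fun k => ((w ^ (p ^ k * q' ^ k * q ^ N) : Circle) : ℂ), ⟨fun k => by simp [Circle.norm_coe], fun k => ?_⟩,
    ⟨m, hm1, ?_⟩, fun k hk => ?_⟩
  · rw [corr_zero_iff, ← Circle.coe_pow, ← Circle.coe_pow, ← pow_mul, ← pow_mul, hmod]
    have h := (hq'.mul_left (p ^ (k + 1) * q' ^ k * q ^ N))
    calc p ^ (k + 1) * q' ^ (k + 1) * q ^ N * q
        = p ^ (k + 1) * q' ^ k * q ^ N * (q * q') := by ring
      _ ≡ p ^ (k + 1) * q' ^ k * q ^ N * 1 [MOD d] := h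
      _ = p ^ k * q' ^ k * q ^ N * p := by ring
  · funext k
    rw [orbitShift_iterate]
    show ((w ^ _ : Circle) : ℂ) = ((w ^ _ : Circle) : ℂ)
    rw [hmod]
    calc p ^ (k + m) * q' ^ (k + m) * q ^ N
        = p ^ k * q' ^ k * q ^ N * (q' ^ m * p ^ m) := by ring
      _ ≡ p ^ k * q' ^ k * q ^ N * (q' ^ m * q ^ m) [MOD d] := (hpqm.mul_left _).mul_left _
      _ ≡ p ^ k * q' ^ k * q ^ N * 1 [MOD d] := (hqm m).mul_left _
      _ = _ := mul_one _
  · have h1 := hm k (Finset.mem_range.2 (Nat.lt_succ_of_le hk))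
    have h2 : w ^ (p ^ k * q' ^ k * q ^ N) = w ^ (p ^ k * q ^ (N - k)) := hmod ?_
    · show ‖((w ^ (p ^ k * q' ^ k * q ^ N) : Circle) : ℂ) - _‖ < ε
      rw [h2, Circle.coe_pow]
      exact h1
    · calc p ^ k * q' ^ k * q ^ N = p ^ k * q' ^ k * q ^ (k + (N - k)) := by
            rw [Nat.add_sub_cancel' hk]
        _ = p ^ k * q ^ (N - k) * (q' ^ k * q ^ k) := by rw [pow_add]; ring
        _ ≡ p ^ k * q ^ (N - k) * 1 [MOD d] := (hqm k).mul_left _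
        _ = _ := mul_one _

theorem exists_tendsto_periodic (hpq : p.Coprime q) (hqp : q < p) (hq : q ≠ 0) {ζ : ℕ → ℂ}
    (hζ : ζ ∈ circleOrbits p q) :
    ∃ ξ : ℕ → ℕ → ℂ, (∀ N, ξ N ∈ circleOrbits p q ∧ ∃ m, 1 ≤ m ∧ orbitShift^[m] (ξ N) = ξ N) ∧
      Tendsto ξ atTop (𝓝 ζ) := by
  choose ξ h1 h2 h3 using fun N : ℕ =>
    exists_periodic_near hpq hqp hq hζ N (ε := 1 / (N + 1 : ℝ)) (by positivity)
  refine ⟨ξ, fun N => ⟨h1 N, h2 N⟩, tendsto_pi_nhds.2 fun k => ?_⟩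
  refine tendsto_iff_norm_sub_tendsto_zero.2 ?_
  refine squeeze_zero' (Eventually.of_forall fun _ => norm_nonneg _) ?_
    (tendsto_one_div_add_atTop_nhds_zero_nat (𝕜 := ℝ))
  filter_upwards [eventually_ge_atTop k] with N hN
  exact (h3 N k hN).le

/-- Every point of the circle starts an orbit, and every orbit can be prolonged backwards. -/
theorem exists_circleOrbit_pred (hp : p ≠ 0) {ζ : ℕ → ℂ} (hζ : ζ ∈ circleOrbits p q) :
    ∃ ξ ∈ circleOrbits p q, orbitShift ξ = ζ := by
  obtain ⟨z, hz⟩ := IsAlgClosed.exists_pow_nat_eq (ζ 0 ^ q) (Nat.pos_of_ne_zero hp)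
  have hz1 : ‖z‖ = 1 := by
    have h1 : ‖ζ 0‖ = 1 := by simpa using hζ.1 0
    have h2 : ‖z‖ ^ p = 1 := by rw [← norm_pow, hz, norm_pow, h1, one_pow]
    exact (pow_eq_one_iff_of_nonneg (norm_nonneg z) hp).1 h2
  refine ⟨fun n => Nat.casesOn n z ζ, ⟨fun n => ?_, fun n => ?_⟩, rfl⟩
  · cases n with
    | zero => simpa using hz1
    | succ n => exact hζ.1 n
  · cases n with
    | zero => exact corr_zero_iff.2 hz.symm
    | succ n => exact hζ.2 n

theorem exists_circleOrbit (hq : q ≠ 0) {z : ℂ} (hz : ‖z‖ = 1) :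
    ∃ ζ ∈ circleOrbits p q, ζ 0 = z := by
  have hstep : ∀ w : ℂ, ∃ w' : ℂ, w' ^ q = w ^ p := fun w =>
    IsAlgClosed.exists_pow_nat_eq (w ^ p) (Nat.pos_of_ne_zero hq)
  choose g hg using hstep
  have hn : ∀ n, ‖g^[n] z‖ = 1 := by
    intro n
    induction n with
    | zero => exact hz
    | succ n ih =>
      rw [Function.iterate_succ_apply']
      have h2 : ‖g (g^[n] z)‖ ^ q = 1 := by rw [← norm_pow, hg, norm_pow, ih, one_pow]
      exact (pow_eq_one_iff_of_nonneg (norm_nonneg _) hq).1 h2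
  refine ⟨fun n => g^[n] z, ⟨fun n => by simpa using hn n, fun n => corr_zero_iff.2 ?_⟩, rfl⟩
  simp only [Function.iterate_succ_apply']
  exact hg _

/-! ### Admissible parameters for the circle -/

/-- The images of a point differ by q-th roots of unity, so rotation reduces disjointness to the
finitely many distances r|ω - 1|. -/
theorem admissible_circle_iff (hp : p ≠ 0) (hq : q ≠ 0) {r δ : ℝ} (hr : 0 < r) (hr' : r < 1 / 2) :
    Admissible p q 0 (Metric.sphere 0 1) r δ ↔
      0 < δ ∧ r + δ ≤ 1 ∧ ∀ ω : ℂ, ω ^ q = 1 → ω ≠ 1 → 2 * δ < r * ‖ω - 1‖ := by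
  have hd : ∀ a b : ℂ, dist ((r : ℂ) * a) (r * b) = r * ‖a - b‖ := by
    intro a b
    rw [dist_eq_norm, ← mul_sub, norm_mul, Complex.norm_real, Real.norm_of_nonneg hr.le]
  constructor
  · intro h
    have h1 : Corr p q 0 1 1 := corr_zero_iff.2 (by simp)
    refine ⟨h.2.2.2.1, ?_, fun ω hω hne => ?_⟩
    · simpa using h.norm_le (z := 1) (w := 1) (by simp) (by simp) h1
    · have hω1 : ‖ω‖ = 1 := (pow_eq_one_iff_of_nonneg (norm_nonneg _) hq).1
        (by rw [← norm_pow, hω, norm_one])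
      have := (h.2.2.2.2 1 (by simp) 1 (by simp) h1).2 ω (by simpa using hω1)
        (corr_zero_iff.2 (by simpa using hω)) hne
      rw [disjoint_closedBall_closedBall_iff h.2.2.2.1.le h.2.2.2.1.le, dist_comm, hd] at this
      linarith
  · rintro ⟨h1, h2, h3⟩
    have hann : ∀ z : ℂ, ‖z‖ = 1 → z ∈ annulusA r := by
      intro z hz
      refine ⟨by rw [hz]; linarith, ?_⟩
      rw [hz, lt_div_iff₀ (by positivity)]
      linarith
    refine ⟨hr, by simp, ⟨isCompact_sphere _ _, ⟨fun z hz => ?_, fun z hz => ?_⟩, fun z hz => ?_⟩,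
      h1, fun z hz w hw hzw => ⟨?_, fun w' hw' hzw' hne => ?_⟩⟩
    · obtain ⟨ζ, hζ, rfl⟩ := exists_circleOrbit (p := p) hq (mem_sphere_zero_iff_norm.1 hz)
      exact ⟨ζ 1, hζ.1 1, hζ.2 0⟩
    · obtain ⟨ζ, hζ, rfl⟩ := exists_circleOrbit (p := p) hq (mem_sphere_zero_iff_norm.1 hz)
      obtain ⟨ξ, hξ, rfl⟩ := exists_circleOrbit_pred hp hζ
      exact ⟨ξ 0, hξ.1 0, hξ.2 0⟩
    · rw [sub_zero]
      exact ⟨hann z (mem_sphere_zero_iff_norm.1 hz), hann z (mem_sphere_zero_iff_norm.1 hz)⟩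
    · refine Metric.closedBall_subset_closedBall' ?_
      rw [dist_zero_right, norm_mul, Complex.norm_real, Real.norm_of_nonneg hr.le,
        mem_sphere_zero_iff_norm.1 hw]
      linarith
    · rw [disjoint_closedBall_closedBall_iff h1.le h1.le, hd]
      have hw1 := mem_sphere_zero_iff_norm.1 hw
      have hw0 : w ≠ 0 := norm_pos_iff.1 (by rw [hw1]; exact one_pos)
      have := h3 (w' / w) (by
        rw [div_pow, corr_zero_iff.1 hzw', ← corr_zero_iff.1 hzw, div_self (pow_ne_zero q hw0)])
        (by rwa [Ne, div_eq_one_iff_eq hw0])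
      rw [div_sub_one hw0, norm_div, hw1, div_one, norm_sub_rev] at this
      linarith

theorem exists_admissible_circle (hp : p ≠ 0) (hq : q ≠ 0) {r : ℝ} (hr : 0 < r)
    (hr' : r < 1 / 2) : ∃ δ, Admissible p q 0 (Metric.sphere 0 1) r δ := by
  have hev : ∀ᶠ δ in 𝓝[>] (0 : ℝ), ∀ ω ∈ {ω : ℂ | ω ^ q = 1}, ω ≠ 1 → 2 * δ < r * ‖ω - 1‖ := by
    refine (finite_roots_of_unity hq).eventually_all.2 fun ω _ => ?_
    by_cases hω : ω = 1
    · exact Eventually.of_forall fun _ h => absurd hω h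
    · have h0 : 0 < r * ‖ω - 1‖ / 2 := by
        have := norm_pos_iff.2 (sub_ne_zero.2 hω); positivity
      filter_upwards [Ioo_mem_nhdsGT h0] with δ hδ _
      linarith [hδ.2]
  obtain ⟨δ, h1, h2⟩ := (hev.and (Ioo_mem_nhdsGT (show (0 : ℝ) < 1 / 2 by norm_num))).exists
  exact ⟨δ, (admissible_circle_iff hp hq hr hr').2 ⟨h2.1, by linarith [h2.2], h1⟩⟩

end Circle

/-! ### The motion of the orbits on the circle -/

/-- Take suprema on both sides. The a priori bound B only makes the supremum finite and disappears
from the conclusion; with A = 0 this is the uniqueness principle for bounded solutions used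
throughout. -/
theorem le_div_of_le_add_mul {a : ℕ → ℝ} {A B lam : ℝ} (hlam : 0 ≤ lam) (hlam' : lam < 1)
    (hB : ∀ n, a n ≤ B) (h : ∀ n, a n ≤ A + lam * a (n + 1)) (n : ℕ) : a n ≤ A / (1 - lam) := by
  have hbdd : BddAbove (range a) := ⟨B, by rintro _ ⟨n, rfl⟩; exact hB n⟩
  have h1 : (⨆ n, a n) ≤ A + lam * ⨆ n, a n := ciSup_le fun n =>
    (h n).trans (add_le_add_right (mul_le_mul_of_nonneg_left (le_ciSup hbdd (n + 1)) hlam) _)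
  refine (le_ciSup hbdd n).trans ?_
  rw [le_div_iff₀ (by linarith)]
  linarith

theorem norm_log_one_sub_sub_le {x y : ℂ} (hx : ‖x‖ ≤ 1 / 2) (hy : ‖y‖ ≤ 1 / 2) :
    ‖Complex.log (1 - x) - Complex.log (1 - y)‖ ≤ 2 * ‖x - y‖ := by
  refine (convex_closedBall (0 : ℂ) (1 / 2)).norm_image_sub_le_of_norm_hasDerivWithin_le
    (f := fun z => Complex.log (1 - z)) (f' := fun z => -1 / (1 - z)) (C := 2)
    (fun z hz => ?_) (fun z hz => ?_) (mem_closedBall_zero_iff.2 hy) (mem_closedBall_zero_iff.2 hx)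
  · rw [mem_closedBall_zero_iff] at hz
    have hs : 1 - z ∈ Complex.slitPlane := by
      rw [sub_eq_add_neg]
      exact Complex.mem_slitPlane_of_norm_lt_one (by rw [norm_neg]; linarith)
    exact (((hasDerivAt_id z).const_sub 1).clog hs).hasDerivWithinAt
  · rw [mem_closedBall_zero_iff] at hz
    have h1 : 1 - ‖z‖ ≤ ‖1 - z‖ := by simpa using norm_sub_norm_le (1 : ℂ) z
    rw [norm_div, norm_neg, norm_one, div_le_iff₀ (by linarith)]
    linarith

theorem norm_log_one_sub_le {x : ℂ} (hx : ‖x‖ ≤ 1 / 2) : ‖Complex.log (1 - x)‖ ≤ 2 * ‖x‖ := by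
  simpa using norm_log_one_sub_sub_le hx (y := 0) (by simp)

theorem norm_exp_le_three {s : ℂ} (hs : ‖s‖ ≤ 1) : ‖Complex.exp s‖ ≤ 3 := by
  rw [Complex.norm_exp]
  have h1 : s.re ≤ 1 := (Complex.re_le_norm s).trans hs
  exact (Real.exp_le_exp.2 h1).trans (by linarith [Real.exp_one_lt_d9])

theorem norm_exp_sub_exp_le {s t : ℂ} (hs : ‖s‖ ≤ 1) (ht : ‖t‖ ≤ 1) :
    ‖Complex.exp s - Complex.exp t‖ ≤ 3 * ‖s - t‖ :=
  (convex_closedBall (0 : ℂ) 1).norm_image_sub_le_of_norm_hasDerivWithin_le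
    (fun z _ => (Complex.hasDerivAt_exp z).hasDerivWithinAt)
    (fun _ hz => norm_exp_le_three (mem_closedBall_zero_iff.1 hz)) (mem_closedBall_zero_iff.2 ht)
    (mem_closedBall_zero_iff.2 hs)

/-- The step of the fixed point equation for the logarithmic displacement. -/
noncomputable def logStep (κ : ℝ) (a s : ℂ) : ℂ :=
  κ * (s + Complex.log (1 - a * Complex.exp (-s)))

/-- Conditions under which `logStep κ a` contracts the unit disk when `‖a‖ ≤ ε`. -/
structure ContractionBound (κ ε : ℝ) : Prop where
  pos : 0 < κ
  lt_one : κ < 1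
  eps_pos : 0 < ε
  eps_le : ε ≤ 1 / 6
  mul_le : κ * (1 + 6 * ε) ≤ (1 + κ) / 2

section LogStep

variable {κ ε : ℝ} {a b s t : ℂ}

theorem ContractionBound.norm_mul_exp_le (h : ContractionBound κ ε) (ha : ‖a‖ ≤ ε)
    (hs : ‖s‖ ≤ 1) : ‖a * Complex.exp (-s)‖ ≤ 1 / 2 := by
  rw [norm_mul]
  have h1 := norm_exp_le_three (s := -s) (by rwa [norm_neg])
  calc ‖a‖ * ‖Complex.exp (-s)‖ ≤ ε * 3 :=
        mul_le_mul ha h1 (norm_nonneg _) h.eps_pos.le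
    _ ≤ 1 / 2 := by linarith [h.eps_le]

theorem ContractionBound.norm_logStep_le (h : ContractionBound κ ε) (ha : ‖a‖ ≤ ε)
    (hs : ‖s‖ ≤ 1) : ‖logStep κ a s‖ ≤ 1 := by
  have h1 := norm_log_one_sub_le (h.norm_mul_exp_le ha hs)
  rw [norm_mul] at h1
  have h2 := norm_exp_le_three (s := -s) (by rwa [norm_neg])
  have h3 : ‖a‖ * ‖Complex.exp (-s)‖ ≤ ε * 3 :=
    mul_le_mul ha h2 (norm_nonneg _) h.eps_pos.le
  rw [logStep, norm_mul, Complex.norm_real, Real.norm_of_nonneg h.pos.le]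
  calc _ ≤ κ * (1 + 6 * ε) :=
        mul_le_mul_of_nonneg_left ((norm_add_le _ _).trans (by linarith)) h.pos.le
    _ ≤ 1 := by linarith [h.mul_le, h.lt_one]

/-- The constant 6 is the product of the Lipschitz constant 2 of log(1 - x) on |x| ≤ 1/2 and the
bound 3 for exp and its derivative on the unit disk. The rate is κ(1 + 6ε), relaxed to (1 + κ)/2. -/
theorem ContractionBound.norm_logStep_sub_le (h : ContractionBound κ ε) (ha : ‖a‖ ≤ ε)
    (hb : ‖b‖ ≤ ε) (hs : ‖s‖ ≤ 1) (ht : ‖t‖ ≤ 1) :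
    ‖logStep κ a s - logStep κ b t‖ ≤ 6 * ‖a - b‖ + (1 + κ) / 2 * ‖s - t‖ := by
  have h1 := norm_log_one_sub_sub_le (h.norm_mul_exp_le ha hs) (h.norm_mul_exp_le hb ht)
  have h2 := norm_exp_le_three (s := -s) (by rwa [norm_neg])
  have h3 := norm_exp_sub_exp_le (s := -s) (t := -t) (by rwa [norm_neg]) (by rwa [norm_neg])
  have h3' : ‖-s - -t‖ = ‖s - t‖ := by rw [neg_sub_neg, norm_sub_rev]
  rw [h3'] at h3
  have h4 : ‖a * Complex.exp (-s) - b * Complex.exp (-t)‖ ≤ ‖a - b‖ * 3 + ε * (3 * ‖s - t‖) := by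
    have : a * Complex.exp (-s) - b * Complex.exp (-t) =
        (a - b) * Complex.exp (-s) + b * (Complex.exp (-s) - Complex.exp (-t)) := by ring
    rw [this]
    refine (norm_add_le _ _).trans (add_le_add ?_ ?_)
    · rw [norm_mul]; exact mul_le_mul_of_nonneg_left h2 (norm_nonneg _)
    · rw [norm_mul]; exact mul_le_mul hb h3 (norm_nonneg _) h.eps_pos.le
  have h5 : logStep κ a s - logStep κ b t = κ * ((s - t) +
      (Complex.log (1 - a * Complex.exp (-s)) - Complex.log (1 - b * Complex.exp (-t)))) := by
    simp only [logStep]; ring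
  rw [h5, norm_mul, Complex.norm_real, Real.norm_of_nonneg h.pos.le]
  have h6 := norm_add_le (s - t)
    (Complex.log (1 - a * Complex.exp (-s)) - Complex.log (1 - b * Complex.exp (-t)))
  calc _ ≤ κ * (‖s - t‖ + 2 * (‖a - b‖ * 3 + ε * (3 * ‖s - t‖))) :=
        mul_le_mul_of_nonneg_left (by linarith) h.pos.le
    _ = κ * (6 * ‖a - b‖) + κ * (1 + 6 * ε) * ‖s - t‖ := by ring
    _ ≤ _ := add_le_add
        (mul_le_of_le_one_left (by positivity) h.lt_one.le)
        (mul_le_mul_of_nonneg_right h.mul_le (norm_nonneg _))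

end LogStep

/-- Approximations of the logarithmic displacement of the orbit `ζ`. -/
noncomputable def logApprox (κ : ℝ) : ℕ → ℂ → (ℕ → ℂ) → ℂ
  | 0, _, _ => 0
  | m + 1, c, ζ => logStep κ (c / ζ 1) (logApprox κ m c (orbitShift ζ))

/-- The logarithmic displacement of the initial point of the orbit `ζ`. -/
noncomputable def logDisp (κ : ℝ) (c : ℂ) (ζ : ℕ → ℂ) : ℂ :=
  limUnder atTop fun m => logApprox κ m c ζ

/-- The orbit of the perturbed correspondence that follows the orbit `ζ`. -/
noncomputable def motionOrbit (κ : ℝ) (c : ℂ) (ζ : ℕ → ℂ) : ℕ → ℂ := fun n =>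
  ζ n * Complex.exp (logDisp κ c (orbitShift^[n] ζ))

/-- Sequences on the unit circle. -/
def unitSeqs : Set (ℕ → ℂ) := {ζ | ∀ n, ‖ζ n‖ = 1}

theorem unitSeqs_shift {ζ : ℕ → ℂ} (h : ζ ∈ unitSeqs) : orbitShift ζ ∈ unitSeqs :=
  fun n => h (n + 1)

theorem unitSeqs_shift_iterate {ζ : ℕ → ℂ} (h : ζ ∈ unitSeqs) (m : ℕ) :
    orbitShift^[m] ζ ∈ unitSeqs := fun n => by rw [orbitShift_iterate]; exact h _

theorem circleOrbits_subset_unitSeqs {p q : ℕ} : circleOrbits p q ⊆ unitSeqs :=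
  fun _ hζ n => mem_sphere_zero_iff_norm.1 (hζ.1 n)

/-! ### Existence, uniqueness and regularity of the logarithmic displacement. -/

section Disp

variable {κ ε : ℝ} {c : ℂ} {ζ : ℕ → ℂ}

theorem norm_div_of_mem_unitSeqs (hζ : ζ ∈ unitSeqs) (n : ℕ) : ‖c / ζ n‖ = ‖c‖ := by
  rw [norm_div, hζ n, div_one]

theorem ContractionBound.norm_logApprox_le (h : ContractionBound κ ε) (hc : ‖c‖ ≤ ε) (m : ℕ)
    (hζ : ζ ∈ unitSeqs) : ‖logApprox κ m c ζ‖ ≤ 1 := by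
  induction m generalizing ζ with
  | zero => simp [logApprox]
  | succ m ih =>
    exact h.norm_logStep_le ((norm_div_of_mem_unitSeqs hζ 1).trans_le hc) (ih (unitSeqs_shift hζ))

theorem ContractionBound.dist_logApprox_le (h : ContractionBound κ ε) (hc : ‖c‖ ≤ ε) (m : ℕ)
    (hζ : ζ ∈ unitSeqs) :
    dist (logApprox κ m c ζ) (logApprox κ (m + 1) c ζ) ≤ 1 * ((1 + κ) / 2) ^ m := by
  induction m generalizing ζ with
  | zero => simpa [logApprox] using h.norm_logApprox_le hc 1 hζ
  | succ m ih =>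
    have hc' := (norm_div_of_mem_unitSeqs (c := c) hζ 1).trans_le hc
    have hζ' := unitSeqs_shift hζ
    have h1 := h.norm_logStep_sub_le hc' hc' (h.norm_logApprox_le hc m hζ')
      (h.norm_logApprox_le hc (m + 1) hζ')
    rw [sub_self, norm_zero, mul_zero, zero_add] at h1
    rw [dist_eq_norm]
    refine h1.trans ?_
    have h2 := ih hζ'
    rw [dist_eq_norm] at h2
    have : 0 ≤ (1 + κ) / 2 := by linarith [h.pos]
    calc _ ≤ (1 + κ) / 2 * (1 * ((1 + κ) / 2) ^ m) := mul_le_mul_of_nonneg_left h2 this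
      _ = _ := by ring

theorem ContractionBound.tendsto_logApprox (h : ContractionBound κ ε) (hc : ‖c‖ ≤ ε)
    (hζ : ζ ∈ unitSeqs) : Tendsto (fun m => logApprox κ m c ζ) atTop (𝓝 (logDisp κ c ζ)) :=
  (cauchySeq_of_le_geometric _ 1 (by linarith [h.lt_one])
    fun m => h.dist_logApprox_le hc m hζ).tendsto_limUnder

theorem ContractionBound.dist_logApprox_logDisp_le (h : ContractionBound κ ε) (hc : ‖c‖ ≤ ε)
    (hζ : ζ ∈ unitSeqs) (m : ℕ) :
    dist (logApprox κ m c ζ) (logDisp κ c ζ) ≤ 1 * ((1 + κ) / 2) ^ m / (1 - (1 + κ) / 2) :=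
  dist_le_of_le_geometric_of_tendsto _ 1 (by linarith [h.lt_one])
    (fun m => h.dist_logApprox_le hc m hζ) (h.tendsto_logApprox hc hζ) m

theorem ContractionBound.tendsto_error (h : ContractionBound κ ε) :
    Tendsto (fun m : ℕ => 1 * ((1 + κ) / 2) ^ m / (1 - (1 + κ) / 2)) atTop (𝓝 0) := by
  have := ((tendsto_pow_atTop_nhds_zero_of_lt_one (r := (1 + κ) / 2) (by linarith [h.pos])
    (by linarith [h.lt_one])).const_mul 1).div_const (1 - (1 + κ) / 2)
  simpa using this

theorem ContractionBound.norm_logDisp_le (h : ContractionBound κ ε) (hc : ‖c‖ ≤ ε)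
    (hζ : ζ ∈ unitSeqs) : ‖logDisp κ c ζ‖ ≤ 1 :=
  le_of_tendsto' (h.tendsto_logApprox hc hζ).norm fun m => h.norm_logApprox_le hc m hζ

theorem ContractionBound.logDisp_eq (h : ContractionBound κ ε) (hc : ‖c‖ ≤ ε)
    (hζ : ζ ∈ unitSeqs) : logDisp κ c ζ = logStep κ (c / ζ 1) (logDisp κ c (orbitShift ζ)) := by
  have hc' := (norm_div_of_mem_unitSeqs (c := c) hζ 1).trans_le hc
  have hζ' := unitSeqs_shift hζ
  refine tendsto_nhds_unique ((h.tendsto_logApprox hc hζ).comp (tendsto_add_atTop_nat 1)) ?_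
  refine tendsto_iff_norm_sub_tendsto_zero.2 ?_
  have h1 := (tendsto_iff_norm_sub_tendsto_zero.1 (h.tendsto_logApprox hc hζ')).const_mul
    ((1 + κ) / 2)
  rw [mul_zero] at h1
  refine squeeze_zero (fun _ => norm_nonneg _) (fun m => ?_) h1
  have h2 := h.norm_logStep_sub_le hc' hc' (h.norm_logApprox_le hc m hζ')
      (h.norm_logDisp_le hc hζ')
  rwa [sub_self, norm_zero, mul_zero, zero_add] at h2

/-- The difference of two solutions with values in the unit disk is bounded and contracts towards
the future, so it vanishes. -/
theorem ContractionBound.eq_logDisp (h : ContractionBound κ ε) (hc : ‖c‖ ≤ ε)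
    (hζ : ζ ∈ unitSeqs) {s : ℕ → ℂ} (hs : ∀ n, ‖s n‖ ≤ 1)
    (hs' : ∀ n, s n = logStep κ (c / ζ (n + 1)) (s (n + 1))) (n : ℕ) :
    s n = logDisp κ c (orbitShift^[n] ζ) := by
  have key := le_div_of_le_add_mul (a := fun n => ‖s n - logDisp κ c (orbitShift^[n] ζ)‖)
    (A := 0) (B := 2) (lam := (1 + κ) / 2) (by linarith [h.pos]) (by linarith [h.lt_one])
    (fun n => (norm_sub_le _ _).trans (by
      linarith [hs n, h.norm_logDisp_le hc (unitSeqs_shift_iterate hζ n)])) (fun n => ?_) n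
  · rw [zero_div] at key
    exact sub_eq_zero.1 (norm_le_zero_iff.1 key)
  · have hn := unitSeqs_shift_iterate hζ n
    have hc' := (norm_div_of_mem_unitSeqs (c := c) hζ (n + 1)).trans_le hc
    have h2 := h.norm_logStep_sub_le hc' hc' (hs (n + 1))
      (h.norm_logDisp_le hc (unitSeqs_shift_iterate hζ (n + 1)))
    rw [h.logDisp_eq hc hn, hs' n, orbitShift_iterate, add_comm 1 n,
      ← Function.iterate_succ_apply' orbitShift]
    simpa using h2

theorem ContractionBound.logDisp_zero (h : ContractionBound κ ε) (hζ : ζ ∈ unitSeqs) :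
    logDisp κ 0 ζ = 0 :=
  (h.eq_logDisp (c := 0) (by simpa using h.eps_pos.le) hζ (s := fun _ => 0) (by simp)
    (by simp [logStep]) 0).symm

theorem ContractionBound.norm_logDisp_sub_le (h : ContractionBound κ ε) {u v : ℂ} (hu : ‖u‖ ≤ ε)
    (hv : ‖v‖ ≤ ε) (hζ : ζ ∈ unitSeqs) :
    ‖logDisp κ u ζ - logDisp κ v ζ‖ ≤ 12 / (1 - κ) * ‖u - v‖ := by
  have key := le_div_of_le_add_mul
    (a := fun n => ‖logDisp κ u (orbitShift^[n] ζ) - logDisp κ v (orbitShift^[n] ζ)‖)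
    (A := 6 * ‖u - v‖) (B := 2) (lam := (1 + κ) / 2) (by linarith [h.pos])
    (by linarith [h.lt_one]) (fun n => (norm_sub_le _ _).trans (by
      linarith [h.norm_logDisp_le hu (unitSeqs_shift_iterate hζ n),
        h.norm_logDisp_le hv (unitSeqs_shift_iterate hζ n)])) (fun n => ?_) 0
  · refine key.trans_eq ?_
    have : 1 - κ ≠ 0 := by linarith [h.lt_one]
    have h3 : 1 - (1 + κ) / 2 = (1 - κ) / 2 := by ring
    rw [h3]
    field_simp
    ring
  · have hn := unitSeqs_shift_iterate hζ n
    have hn' := unitSeqs_shift_iterate hζ (n + 1)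
    have h2 := h.norm_logStep_sub_le ((norm_div_of_mem_unitSeqs (c := u) hn 1).trans_le hu)
      ((norm_div_of_mem_unitSeqs (c := v) hn 1).trans_le hv) (h.norm_logDisp_le hu hn')
      (h.norm_logDisp_le hv hn')
    rw [← sub_div, norm_div_of_mem_unitSeqs hn] at h2
    rw [h.logDisp_eq hu hn, h.logDisp_eq hv hn, ← Function.iterate_succ_apply' orbitShift]
    exact h2

theorem ContractionBound.one_sub_mem_slitPlane (h : ContractionBound κ ε) {a s : ℂ}
    (ha : ‖a‖ ≤ ε) (hs : ‖s‖ ≤ 1) : 1 - a * Complex.exp (-s) ∈ Complex.slitPlane := by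
  rw [sub_eq_add_neg]
  refine Complex.mem_slitPlane_of_norm_lt_one ?_
  rw [norm_neg]
  linarith [h.norm_mul_exp_le ha hs]

theorem ContractionBound.continuousOn_logApprox (h : ContractionBound κ ε) (hc : ‖c‖ ≤ ε)
    (m : ℕ) : ContinuousOn (fun ζ => logApprox κ m c ζ) unitSeqs := by
  induction m with
  | zero => exact continuousOn_const
  | succ m ih =>
    have h1 : ContinuousOn (fun ζ => logApprox κ m c (orbitShift ζ)) unitSeqs :=
      ih.comp continuous_orbitShift.continuousOn fun ζ hζ => unitSeqs_shift hζ
    have h2 : ContinuousOn (fun ζ : ℕ → ℂ => c / ζ 1) unitSeqs :=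
      continuousOn_const.div (continuous_apply 1).continuousOn fun ζ hζ =>
        norm_ne_zero_iff.1 (by rw [hζ 1]; exact one_ne_zero)
    refine continuousOn_const.mul (h1.add (ContinuousOn.clog
      (continuousOn_const.sub (h2.mul (h1.neg.cexp))) fun ζ hζ => ?_))
    exact h.one_sub_mem_slitPlane ((norm_div_of_mem_unitSeqs hζ 1).trans_le hc)
      (h.norm_logApprox_le hc m (unitSeqs_shift hζ))

/-- The approximations converge at a geometric rate independent of both ζ and c, so continuity in ζ,
and likewise holomorphy in c, passes to the limit. -/
theorem ContractionBound.continuousOn_logDisp (h : ContractionBound κ ε) (hc : ‖c‖ ≤ ε) :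
    ContinuousOn (logDisp κ c) unitSeqs := by
  have hu : TendstoUniformlyOn (fun m ζ => logApprox κ m c ζ) (logDisp κ c) atTop unitSeqs := by
    refine Metric.tendstoUniformlyOn_iff.2 fun e he => ?_
    filter_upwards [h.tendsto_error.eventually_lt_const he] with m hm ζ hζ
    rw [dist_comm]
    exact (h.dist_logApprox_logDisp_le hc hζ m).trans_lt hm
  exact hu.continuousOn (Frequently.of_forall fun m => h.continuousOn_logApprox hc m)

theorem ContractionBound.differentiableOn_logApprox (h : ContractionBound κ ε)
    (hζ : ζ ∈ unitSeqs) (m : ℕ) :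
    DifferentiableOn ℂ (fun c => logApprox κ m c ζ) (Metric.ball 0 ε) := by
  induction m generalizing ζ with
  | zero => exact differentiableOn_const _
  | succ m ih =>
    have h1 := ih (unitSeqs_shift hζ)
    have h2 : DifferentiableOn ℂ (fun c : ℂ => c / ζ 1) (Metric.ball 0 ε) :=
      differentiableOn_id.div_const _
    refine (h1.add (DifferentiableOn.clog ((h2.mul h1.neg.cexp).const_sub 1)
      fun c hc => ?_)).const_mul _
    have hc' := (mem_ball_zero_iff.1 hc).le
    exact h.one_sub_mem_slitPlane ((norm_div_of_mem_unitSeqs hζ 1).trans_le hc')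
      (h.norm_logApprox_le hc' m (unitSeqs_shift hζ))

theorem ContractionBound.differentiableOn_logDisp (h : ContractionBound κ ε)
    (hζ : ζ ∈ unitSeqs) : DifferentiableOn ℂ (fun c => logDisp κ c ζ) (Metric.ball 0 ε) := by
  have hu : TendstoUniformlyOn (fun m c => logApprox κ m c ζ) (fun c => logDisp κ c ζ) atTop
      (Metric.ball 0 ε) := by
    refine Metric.tendstoUniformlyOn_iff.2 fun e he => ?_
    filter_upwards [h.tendsto_error.eventually_lt_const he] with m hm c hc
    rw [dist_comm]
    exact (h.dist_logApprox_logDisp_le (mem_ball_zero_iff.1 hc).le hζ m).trans_lt hm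
  exact hu.tendstoLocallyUniformlyOn.differentiableOn
    (Eventually.of_forall fun m => h.differentiableOn_logApprox hζ m) Metric.isOpen_ball

/-- The n-th displacement depends only on the future of ζ from time n. This is the source of the
conjugacy between the bundle maps. -/
theorem motionOrbit_shift : orbitShift (motionOrbit κ c ζ) = motionOrbit κ c (orbitShift ζ) := rfl

theorem motionOrbit_shift_iterate (n : ℕ) :
    orbitShift^[n] (motionOrbit κ c ζ) = motionOrbit κ c (orbitShift^[n] ζ) := by
  induction n generalizing ζ with
  | zero => rfl
  | succ n ih => rw [Function.iterate_succ_apply, motionOrbit_shift, ih]; rfl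

theorem ContractionBound.motionOrbit_zero (h : ContractionBound κ ε) (hζ : ζ ∈ unitSeqs) :
    motionOrbit κ 0 ζ = ζ := by
  funext n
  rw [motionOrbit, h.logDisp_zero (unitSeqs_shift_iterate hζ n), Complex.exp_zero, mul_one]

theorem ContractionBound.norm_motionOrbit_sub_le (h : ContractionBound κ ε) {u v : ℂ}
    (hu : ‖u‖ ≤ ε) (hv : ‖v‖ ≤ ε) (hζ : ζ ∈ unitSeqs) (n : ℕ) :
    ‖motionOrbit κ u ζ n - motionOrbit κ v ζ n‖ ≤ 36 / (1 - κ) * ‖u - v‖ := by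
  have hn := unitSeqs_shift_iterate hζ n
  rw [motionOrbit, motionOrbit, ← mul_sub, norm_mul, hζ n, one_mul]
  refine (norm_exp_sub_exp_le (h.norm_logDisp_le hu hn) (h.norm_logDisp_le hv hn)).trans ?_
  calc _ ≤ 3 * (12 / (1 - κ) * ‖u - v‖) :=
        mul_le_mul_of_nonneg_left (h.norm_logDisp_sub_le hu hv hn) (by norm_num)
    _ = _ := by ring

theorem ContractionBound.abs_norm_motionOrbit_sub_one_le (h : ContractionBound κ ε)
    (hc : ‖c‖ ≤ ε) (hζ : ζ ∈ unitSeqs) (n : ℕ) :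
    |‖motionOrbit κ c ζ n‖ - 1| ≤ 36 / (1 - κ) * ‖c‖ := by
  have h0 : ‖(0 : ℂ)‖ ≤ ε := by rw [norm_zero]; exact h.eps_pos.le
  have h1 := h.norm_motionOrbit_sub_le hc h0 hζ n
  rw [h.motionOrbit_zero hζ, sub_zero] at h1
  have h2 := abs_norm_sub_norm_le (motionOrbit κ c ζ n) (ζ n)
  rw [hζ n] at h2
  exact h2.trans h1

theorem ContractionBound.continuousOn_motionOrbit (h : ContractionBound κ ε) (hc : ‖c‖ ≤ ε) :
    ContinuousOn (motionOrbit κ c) unitSeqs := by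
  refine continuousOn_pi.2 fun n => (continuous_apply n).continuousOn.mul ?_
  exact ((h.continuousOn_logDisp hc).comp (continuous_orbitShift.iterate n).continuousOn
    fun ζ hζ => unitSeqs_shift_iterate hζ n).cexp

theorem ContractionBound.differentiableOn_motionOrbit (h : ContractionBound κ ε)
    (hζ : ζ ∈ unitSeqs) (n : ℕ) :
    DifferentiableOn ℂ (fun c => motionOrbit κ c ζ n) (Metric.ball 0 ε) :=
  (h.differentiableOn_logDisp (unitSeqs_shift_iterate hζ n)).cexp.const_mul _

/-- The displacement in terms of the displaced orbit. -/
theorem ContractionBound.logDisp_eq_motionOrbit (h : ContractionBound κ ε) (hc : ‖c‖ ≤ ε)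
    (hζ : ζ ∈ unitSeqs) (n : ℕ) : logDisp κ c (orbitShift^[n] ζ) =
      κ * (logDisp κ c (orbitShift^[n + 1] ζ) +
        Complex.log (1 - c / motionOrbit κ c ζ (n + 1))) := by
  rw [h.logDisp_eq hc (unitSeqs_shift_iterate hζ n), logStep, orbitShift_iterate, add_comm 1 n,
    ← Function.iterate_succ_apply' orbitShift, motionOrbit, Complex.exp_neg, ← div_eq_mul_inv,
    div_div]

/-- Once the displaced orbit w is known, s_n = κ (s_{n+1} + log(1 - c/w_{n+1})) is affine in s with
contraction factor κ, so w determines the displacements and hence ζ. -/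
theorem ContractionBound.motionOrbit_injOn (h : ContractionBound κ ε) (hc : ‖c‖ ≤ ε) :
    InjOn (motionOrbit κ c) unitSeqs := by
  intro ζ hζ ξ hξ e
  have key := le_div_of_le_add_mul
    (a := fun n => ‖logDisp κ c (orbitShift^[n] ζ) - logDisp κ c (orbitShift^[n] ξ)‖)
    (A := 0) (B := 2) (lam := κ) h.pos.le h.lt_one (fun n => (norm_sub_le _ _).trans (by
      linarith [h.norm_logDisp_le hc (unitSeqs_shift_iterate hζ n),
        h.norm_logDisp_le hc (unitSeqs_shift_iterate hξ n)])) (fun n => ?_)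
  · funext n
    have h1 := key n
    rw [zero_div] at h1
    have h2 := sub_eq_zero.1 (norm_le_zero_iff.1 h1)
    have h3 := congrFun e n
    rw [motionOrbit, motionOrbit, h2] at h3
    exact mul_right_cancel₀ (Complex.exp_ne_zero _) h3
  · rw [h.logDisp_eq_motionOrbit hc hζ n, h.logDisp_eq_motionOrbit hc hξ n, e, ← mul_sub,
      add_sub_add_right_eq_sub, norm_mul, Complex.norm_real, Real.norm_of_nonneg h.pos.le, zero_add]

end Disp

/-! ### Displaced orbits are orbits, and every bounded orbit away from 0 is one. -/

section Shadowing

variable {p q : ℕ} {ε : ℝ} {c : ℂ} {ζ : ℕ → ℂ}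

theorem motionOrbit_ne_zero {κ : ℝ} (hζ : ζ ∈ unitSeqs) (n : ℕ) :
    motionOrbit κ c ζ n ≠ 0 :=
  mul_ne_zero (norm_ne_zero_iff.1 (by rw [hζ n]; exact one_ne_zero)) (Complex.exp_ne_zero _)

/-- Multiply the fixed point equation by p and exponentiate: integer multiples of the logarithm
leave no ambiguity of branch. -/
theorem ContractionBound.corr_motionOrbit (h : ContractionBound (q / p : ℝ) ε) (hp : p ≠ 0)
    (hc : ‖c‖ ≤ ε) (hζ : ζ ∈ circleOrbits p q) (n : ℕ) :
    Corr p q c (motionOrbit (q / p) c ζ n) (motionOrbit (q / p) c ζ (n + 1)) := by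
  have hu := circleOrbits_subset_unitSeqs hζ
  have hp' : (p : ℂ) ≠ 0 := Nat.cast_ne_zero.2 hp
  set w := motionOrbit (q / p) c ζ with hw
  have hw1 : w (n + 1) ≠ 0 := motionOrbit_ne_zero hu _
  have hlog := h.logDisp_eq_motionOrbit hc hu n
  rw [← hw] at hlog
  have hne : 1 - c / w (n + 1) ≠ 0 := by
    have h1 := h.norm_mul_exp_le ((norm_div_of_mem_unitSeqs (c := c) hu (n + 1)).trans_le hc)
      (h.norm_logDisp_le hc (unitSeqs_shift_iterate hu (n + 1)))
    rw [Complex.exp_neg, ← div_eq_mul_inv, div_div] at h1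
    change ‖c / w (n + 1)‖ ≤ 1 / 2 at h1
    intro h0
    rw [← sub_eq_zero.1 h0, norm_one] at h1
    norm_num at h1
  have hmul : (p : ℂ) * logDisp (q / p) c (orbitShift^[n] ζ) =
      q * logDisp (q / p) c (orbitShift^[n + 1] ζ) + q * Complex.log (1 - c / w (n + 1)) := by
    rw [hlog]
    push_cast
    field_simp
  have e1 : w n ^ p = ζ n ^ p * Complex.exp (p * logDisp (q / p) c (orbitShift^[n] ζ)) := by
    rw [Complex.exp_nat_mul, ← mul_pow]; rfl
  have e2 : w (n + 1) ^ q =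
      ζ (n + 1) ^ q * Complex.exp (q * logDisp (q / p) c (orbitShift^[n + 1] ζ)) := by
    rw [Complex.exp_nat_mul, ← mul_pow]; rfl
  have e3 : w (n + 1) - c = w (n + 1) * (1 - c / w (n + 1)) := by field_simp
  rw [Corr, e3, mul_pow, e1, e2, hmul, Complex.exp_add, Complex.exp_nat_mul _ q,
    Complex.exp_nat_mul _ q, Complex.exp_log hne, corr_zero_iff.1 (hζ.2 n), mul_assoc]

/-- Every bounded orbit that stays away from the origin follows an orbit on the circle. -/
theorem ContractionBound.exists_motionOrbit_eq (h : ContractionBound (q / p : ℝ) ε) (hp : p ≠ 0)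
    (hq : q ≠ 0) (hc : ‖c‖ ≤ ε) {ρ R : ℝ} (hρ : 0 < ρ) (hcρ : 2 * ‖c‖ ≤ (1 - q / p) * ρ)
    {w : ℕ → ℂ} (hw : ∀ n, Corr p q c (w n) (w (n + 1))) (hwρ : ∀ n, ρ ≤ ‖w n‖)
    (hwR : ∀ n, ‖w n‖ ≤ R) : ∃ ζ ∈ circleOrbits p q, motionOrbit (q / p) c ζ = w := by
  have hp' : (p : ℂ) ≠ 0 := Nat.cast_ne_zero.2 hp
  set κ : ℝ := q / p with hκ
  have hκ' : (κ : ℂ) = q / p := by rw [hκ]; push_cast; rfl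
  have hw0 : ∀ n, w n ≠ 0 := fun n => norm_pos_iff.1 (hρ.trans_le (hwρ n))
  have hdiv : ∀ n, 2 * ‖c / w n‖ ≤ 1 - κ := by
    intro n
    rw [norm_div, ← mul_div_assoc, div_le_iff₀ (hρ.trans_le (hwρ n))]
    exact hcρ.trans (mul_le_mul_of_nonneg_left (hwρ n) (by linarith [h.lt_one]))
  have hdiv' : ∀ n, ‖c / w n‖ ≤ 1 / 2 := fun n => by linarith [hdiv n, h.pos]
  -- The hypothesis on |c| is tuned to this bound: summed against the powers of κ, it keeps the
  -- displacements below in the unit disk.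
  have hL : ∀ n, ‖Complex.log (1 - c / w n)‖ ≤ 1 - κ := fun n =>
    (norm_log_one_sub_le (hdiv' n)).trans (hdiv n)
  set L : ℕ → ℂ := fun n => Complex.log (1 - c / w n) with hLdef
  have hsum : ∀ n, Summable fun k : ℕ => (κ : ℂ) ^ k * L (n + (k + 1)) := fun n =>
    summable_encoding (ζ := fun k => L (n + k)) h.pos.le h.lt_one fun k => hL _
  -- With w given, the recursion t_n = κ (t_{n+1} + L_{n+1}) is linear and this series is its
  -- bounded solution.
  let t : ℕ → ℂ := fun n => κ * ∑' k : ℕ, (κ : ℂ) ^ k * L (n + (k + 1))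
  have ht : ∀ n, t n = κ * (t (n + 1) + L (n + 1)) := by
    intro n
    have e : ∀ k : ℕ, (κ : ℂ) ^ (k + 1) * L (n + (k + 1 + 1)) =
        κ * ((κ : ℂ) ^ k * L (n + 1 + (k + 1))) := by
      intro k
      rw [show n + (k + 1 + 1) = n + 1 + (k + 1) by ring]
      ring
    have e0 : t n = κ * ∑' k : ℕ, (κ : ℂ) ^ k * L (n + (k + 1)) := rfl
    rw [e0, (hsum n).tsum_eq_zero_add, tsum_congr e, tsum_mul_left, pow_zero, one_mul, zero_add,
      add_comm]
  have ht1 : ∀ n, ‖t n‖ ≤ 1 := by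
    intro n
    have h1 := norm_tsum_encoding_le (ζ := fun k => L (n + k)) h.pos.le h.lt_one fun k => hL _
    rw [inv_mul_cancel₀ (by linarith [h.lt_one])] at h1
    show ‖(κ : ℂ) * _‖ ≤ 1
    rw [norm_mul, Complex.norm_real, Real.norm_of_nonneg h.pos.le]
    exact mul_le_one₀ h.lt_one.le (norm_nonneg _) h1
  let ζ : ℕ → ℂ := fun n => w n * Complex.exp (-t n)
  have hcorr : ∀ n, ζ (n + 1) ^ q = ζ n ^ p := by
    intro n
    have hne : 1 - c / w (n + 1) ≠ 0 := by
      intro h0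
      have h1 := hdiv' (n + 1)
      rw [← sub_eq_zero.1 h0, norm_one] at h1
      norm_num at h1
    have e1 : ζ n ^ p = w n ^ p * Complex.exp (-(p * t n)) := by
      rw [← mul_neg, Complex.exp_nat_mul, ← mul_pow]
    have e2 : ζ (n + 1) ^ q = w (n + 1) ^ q * Complex.exp (-(q * t (n + 1))) := by
      rw [← mul_neg, Complex.exp_nat_mul, ← mul_pow]
    have e3 : (p : ℂ) * t n = q * t (n + 1) + q * L (n + 1) := by
      rw [ht n, hκ']
      field_simp
    have e4 : w (n + 1) - c = w (n + 1) * (1 - c / w (n + 1)) := by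
      have := hw0 (n + 1)
      field_simp
    have e5 := hw n
    rw [Corr, e4, mul_pow] at e5
    rw [e1, e2, e3, ← e5, neg_add, Complex.exp_add, Complex.exp_neg (q * L (n + 1)),
      Complex.exp_nat_mul (L (n + 1)), Complex.exp_log hne]
    field_simp
  have hζ0 : ∀ n, ζ n ≠ 0 := fun n => mul_ne_zero (hw0 n) (Complex.exp_ne_zero _)
  have hlog : ∀ n, Real.log ‖ζ n‖ = κ * Real.log ‖ζ (n + 1)‖ := by
    intro n
    have h1 := congrArg (fun z : ℂ => Real.log ‖z‖) (hcorr n)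
    simp only [norm_pow, Real.log_pow] at h1
    have h2 : (p : ℝ) ≠ 0 := Nat.cast_ne_zero.2 hp
    rw [hκ, div_mul_eq_mul_div, h1]
    field_simp
  have hbound : ∀ n, |Real.log ‖ζ n‖| ≤ max |Real.log ρ| |Real.log R| + 1 := by
    intro n
    have h1 : Real.log ‖ζ n‖ = Real.log ‖w n‖ + (-t n).re := by
      show Real.log ‖w n * Complex.exp (-t n)‖ = _
      rw [norm_mul, Complex.norm_exp, Real.log_mul (norm_ne_zero_iff.2 (hw0 n))
        (Real.exp_ne_zero _), Real.log_exp]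
    rw [h1]
    refine (abs_add_le _ _).trans (add_le_add ?_ ?_)
    · have hwpos := hρ.trans_le (hwρ n)
      exact abs_le_max_abs_abs (Real.log_le_log hρ (hwρ n)) (Real.log_le_log hwpos (hwR n))
    · refine (Complex.abs_re_le_norm _).trans ?_
      rw [norm_neg]
      exact ht1 n
  -- An unperturbed orbit off the circle would have |log|ζ_n|| growing like (p/q)^n; boundedness
  -- excludes this.
  have hzero : ∀ n, |Real.log ‖ζ n‖| ≤ 0 / (1 - κ) :=
    le_div_of_le_add_mul h.pos.le h.lt_one hbound fun n => by
      rw [hlog n, abs_mul, abs_of_pos h.pos, zero_add]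
  have hnorm : ∀ n, ‖ζ n‖ = 1 := by
    intro n
    have h1 := hzero n
    rw [zero_div] at h1
    have h2 := abs_eq_zero.1 (le_antisymm h1 (abs_nonneg _))
    exact Real.eq_one_of_pos_of_log_eq_zero (norm_pos_iff.2 (hζ0 n)) h2
  have hexp : ∀ n, ζ n * Complex.exp (t n) = w n := by
    intro n
    show w n * Complex.exp (-t n) * Complex.exp (t n) = w n
    rw [mul_assoc, ← Complex.exp_add, neg_add_cancel, Complex.exp_zero, mul_one]
  have hst : ∀ n, t n = logDisp κ c (orbitShift^[n] ζ) := by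
    refine h.eq_logDisp hc hnorm ht1 fun n => ?_
    rw [ht n, logStep, Complex.exp_neg, ← div_eq_mul_inv, div_div, hexp]
  refine ⟨ζ, ⟨fun n => mem_sphere_zero_iff_norm.2 (hnorm n), fun n => corr_zero_iff.2 (hcorr n)⟩, ?_⟩
  funext n
  rw [motionOrbit, ← hst n, hexp]

end Shadowing

/-! ### The perturbed invariant sets -/

/-- The width of an annulus around the unit circle that contains the displaced orbits of all
parameters of modulus at most `ε`, and their differences with the parameter. -/
noncomputable def orbitWidth (p q : ℕ) (ε : ℝ) : ℝ := (36 / (1 - q / p) + 1) * ε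

/-- Below this modulus no cycle of the correspondence with a small parameter is repelling. -/
noncomputable def trapRadius (p q : ℕ) : ℝ := (q / p : ℝ) ^ q

/-- Smallness of the radius `ε` of the parameter disk. -/
structure SmallParam (p q : ℕ) (r δ ε : ℝ) : Prop where
  coprime : p.Coprime q
  lt : q < p
  ne_zero : q ≠ 0
  r_pos : 0 < r
  delta_pos : 0 < δ
  contraction : ContractionBound (q / p : ℝ) ε
  -- Serves three purposes: shadowing outside the trapping disk, invariance of that disk, and
  -- expansion of the metric |dz|/|z| outside it.
  two_mul_le : 2 * ε ≤ (1 - q / p) * trapRadius p q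
  -- Leaves a gap between the perturbed sets and the trapping disk, wide enough for the
  -- neighbourhood on which the bundle map is iterated.
  trap_le : trapRadius p q + (1 - trapRadius p q) / 2 ≤ 1 - orbitWidth p q ε
  expanding : q / p * (1 + orbitWidth p q ε) < 1 - orbitWidth p q ε
  r_lt : r < 1 - orbitWidth p q ε
  lt_inv : 1 + orbitWidth p q ε < 1 / (2 * r)
  add_le : r * (1 + orbitWidth p q ε) + δ ≤ 1
  separated : ∀ ω ∈ {ω : ℂ | ω ^ q = 1}, ω ≠ 1 →
    2 * δ < (1 - orbitWidth p q ε) * (r * ‖ω - 1‖)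
  mul_lt : 4 * ε * r < 1

section Ratio

variable {p q : ℕ}

theorem ratio_pos (hqp : q < p) (hq : q ≠ 0) : 0 < (q / p : ℝ) :=
  div_pos (Nat.cast_pos.2 (Nat.pos_of_ne_zero hq)) (Nat.cast_pos.2 (by omega))

theorem ratio_lt_one (hqp : q < p) : (q / p : ℝ) < 1 :=
  (div_lt_one (Nat.cast_pos.2 (by omega))).2 (Nat.cast_lt.2 hqp)

theorem trapRadius_pos (hqp : q < p) (hq : q ≠ 0) : 0 < trapRadius p q :=
  pow_pos (ratio_pos hqp hq) q

theorem trapRadius_lt_one (hqp : q < p) (hq : q ≠ 0) : trapRadius p q < 1 :=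
  pow_lt_one₀ (ratio_pos hqp hq).le (ratio_lt_one hqp) hq

end Ratio

theorem Admissible.exists_smallParam {p q : ℕ} (hpq : p.Coprime q) (hqp : q < p) (hq : q ≠ 0)
    {r δ : ℝ} (hr' : r < 1 / 2) (hq2 : 2 ≤ q) (hA : Admissible p q 0 (Metric.sphere 0 1) r δ) :
    ∃ ε, SmallParam p q r δ ε := by
  have hr := hA.1
  obtain ⟨hδ, -, hsep⟩ := (admissible_circle_iff (by omega) hq hr hr').1 hA
  -- Admissibility gives only r + δ ≤ 1, but stability needs a strict inequality. As q ≥ 2 there is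
  -- a root of unity ω ≠ 1, so 2δ < r|ω - 1| ≤ 2r < 1.
  have hrδ : r + δ < 1 := by
    have hprim := Complex.isPrimitiveRoot_exp q hq
    have h1 := hsep _ hprim.pow_eq_one (hprim.ne_one (by omega))
    have h2 : ‖Complex.exp (2 * Real.pi * Complex.I / q) - 1‖ ≤ 2 := by
      refine (norm_sub_le _ _).trans ?_
      rw [hprim.norm'_eq_one hq, norm_one]
      norm_num
    have := mul_le_mul_of_nonneg_left h2 hr.le
    linarith
  have hκ0 := ratio_pos hqp hq
  have hκ1 := ratio_lt_one hqp
  have hρ0 := trapRadius_pos hqp hq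
  have hρ1 := trapRadius_lt_one hqp hq
  set κ : ℝ := q / p with hκ
  have hid : Tendsto (fun ε : ℝ => ε) (𝓝[>] 0) (𝓝 0) := tendsto_id.mono_left nhdsWithin_le_nhds
  have hτ : Tendsto (orbitWidth p q) (𝓝[>] 0) (𝓝 0) := by
    have := hid.const_mul (36 / (1 - κ) + 1)
    rwa [mul_zero] at this
  have hsub : Tendsto (fun ε => 1 - orbitWidth p q ε) (𝓝[>] 0) (𝓝 1) := by
    simpa using hτ.const_sub 1
  have hadd : Tendsto (fun ε => 1 + orbitWidth p q ε) (𝓝[>] 0) (𝓝 1) := by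
    simpa using hτ.const_add 1
  have e1 : ∀ᶠ ε in 𝓝[>] (0 : ℝ), ε < 1 / 6 := hid.eventually_lt_const (by norm_num)
  have e2 : ∀ᶠ ε in 𝓝[>] (0 : ℝ), κ * (1 + 6 * ε) < (1 + κ) / 2 := by
    have h1 : Tendsto (fun ε => κ * (1 + 6 * ε)) (𝓝[>] 0) (𝓝 (κ * (1 + 6 * 0))) :=
      ((hid.const_mul 6).const_add 1).const_mul κ
    exact h1.eventually_lt_const (by linarith)
  have e3 : ∀ᶠ ε in 𝓝[>] (0 : ℝ), 2 * ε < (1 - κ) * trapRadius p q := by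
    have h1 : Tendsto (fun ε : ℝ => 2 * ε) (𝓝[>] 0) (𝓝 (2 * 0)) := hid.const_mul 2
    refine h1.eventually_lt_const ?_
    rw [mul_zero]
    exact mul_pos (by linarith) hρ0
  have e4 : ∀ᶠ ε in 𝓝[>] (0 : ℝ),
      trapRadius p q + (1 - trapRadius p q) / 2 < 1 - orbitWidth p q ε :=
    hsub.eventually_const_lt (by linarith)
  have e5 : ∀ᶠ ε in 𝓝[>] (0 : ℝ), κ * (1 + orbitWidth p q ε) < 1 - orbitWidth p q ε :=
    (hadd.const_mul κ).eventually_lt hsub (by linarith)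
  have e6 : ∀ᶠ ε in 𝓝[>] (0 : ℝ), r < 1 - orbitWidth p q ε :=
    hsub.eventually_const_lt (by linarith)
  have e7 : ∀ᶠ ε in 𝓝[>] (0 : ℝ), 1 + orbitWidth p q ε < 1 / (2 * r) :=
    hadd.eventually_lt_const (by rw [lt_div_iff₀ (by positivity)]; linarith)
  have e8 : ∀ᶠ ε in 𝓝[>] (0 : ℝ), r * (1 + orbitWidth p q ε) + δ < 1 :=
    ((hadd.const_mul r).add_const δ).eventually_lt_const (by linarith)
  have e9 : ∀ᶠ ε in 𝓝[>] (0 : ℝ), ∀ ω ∈ {ω : ℂ | ω ^ q = 1}, ω ≠ 1 →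
      2 * δ < (1 - orbitWidth p q ε) * (r * ‖ω - 1‖) := by
    refine (finite_roots_of_unity hq).eventually_all.2 fun ω hω => ?_
    by_cases h1 : ω = 1
    · exact Eventually.of_forall fun _ h => absurd h1 h
    · have h2 := (hsub.mul_const (r * ‖ω - 1‖)).eventually_const_lt
        (show 2 * δ < 1 * (r * ‖ω - 1‖) by rw [one_mul]; exact hsep ω hω h1)
      filter_upwards [h2] with ε h3 _ using h3
  have e10 : ∀ᶠ ε in 𝓝[>] (0 : ℝ), 4 * ε * r < 1 :=
    ((hid.const_mul 4).mul_const r).eventually_lt_const (by norm_num)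
  have e11 : ∀ᶠ ε in 𝓝[>] (0 : ℝ), 0 < ε := eventually_mem_nhdsWithin
  obtain ⟨ε, h1, h2, h3, h4, h5, h6, h7, h8, h9, h10, h11⟩ := (e1.and (e2.and (e3.and (e4.and
    (e5.and (e6.and (e7.and (e8.and (e9.and (e10.and e11)))))))))).exists
  exact ⟨ε, hpq, hqp, hq, hr, hδ, ⟨hκ0, hκ1, h11, h1.le, h2.le⟩, h3.le, h4.le, h5, h6, h7, h8.le,
    h9, h10⟩

/-- The set of the initial points of the displaced orbits. -/
noncomputable def perturbedSet (p q : ℕ) (c : ℂ) : Set ℂ :=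
  (fun ζ => motionOrbit (q / p) c ζ 0) '' circleOrbits p q

namespace SmallParam

variable {p q : ℕ} {r δ ε : ℝ} {c : ℂ} {ζ : ℕ → ℂ}

theorem p_ne_zero (h : SmallParam p q r δ ε) : p ≠ 0 := by have := h.lt; omega

theorem trap_pos (h : SmallParam p q r δ ε) : 0 < trapRadius p q := trapRadius_pos h.lt h.ne_zero

theorem trap_lt_one (h : SmallParam p q r δ ε) : trapRadius p q < 1 :=
  trapRadius_lt_one h.lt h.ne_zero

theorem delta_lt_one (h : SmallParam p q r δ ε) : δ < 1 := by
  have h1 : 0 ≤ orbitWidth p q ε := by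
    have := h.contraction.lt_one
    have := h.contraction.eps_pos
    have : 0 < 1 - (q / p : ℝ) := by linarith
    unfold orbitWidth
    positivity
  have h2 : 0 < r * (1 + orbitWidth p q ε) := mul_pos h.r_pos (by linarith)
  linarith [h.add_le]

theorem abs_norm_sub_one_le (h : SmallParam p q r δ ε) (hc : ‖c‖ ≤ ε)
    (hζ : ζ ∈ circleOrbits p q) (n : ℕ) :
    |‖motionOrbit (q / p) c ζ n‖ - 1| + ‖c‖ ≤ orbitWidth p q ε := by
  have h1 := h.contraction.abs_norm_motionOrbit_sub_one_le hc (circleOrbits_subset_unitSeqs hζ) n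
  have h2 : 36 / (1 - (q / p : ℝ)) * ‖c‖ ≤ 36 / (1 - q / p) * ε :=
    mul_le_mul_of_nonneg_left hc (div_nonneg (by norm_num) (by linarith [h.contraction.lt_one]))
  rw [orbitWidth, add_mul, one_mul]
  linarith

theorem abs_norm_le (h : SmallParam p q r δ ε) (hc : ‖c‖ ≤ ε) {z : ℂ}
    (hz : z ∈ perturbedSet p q c) : |‖z‖ - 1| ≤ orbitWidth p q ε := by
  obtain ⟨ζ, hζ, rfl⟩ := hz
  have := h.abs_norm_sub_one_le hc hζ 0
  simp only
  linarith [norm_nonneg c]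

theorem abs_norm_sub_le (h : SmallParam p q r δ ε) (hc : ‖c‖ ≤ ε) {z : ℂ}
    (hz : z ∈ perturbedSet p q c) : |‖z - c‖ - 1| ≤ orbitWidth p q ε := by
  obtain ⟨ζ, hζ, rfl⟩ := hz
  have h1 := h.abs_norm_sub_one_le hc hζ 0
  simp only
  have h2 := abs_norm_sub_norm_le (motionOrbit (q / p) c ζ 0 - c) (motionOrbit (q / p) c ζ 0)
  rw [sub_sub_cancel_left, norm_neg] at h2
  have h3 := abs_sub_le (‖motionOrbit (q / p) c ζ 0 - c‖) (‖motionOrbit (q / p) c ζ 0‖) 1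
  linarith

theorem continuousOn_motionOrbit (h : SmallParam p q r δ ε) (hc : ‖c‖ ≤ ε) :
    ContinuousOn (motionOrbit (q / p) c) (circleOrbits p q) :=
  (h.contraction.continuousOn_motionOrbit hc).mono circleOrbits_subset_unitSeqs

theorem isCompact_perturbedSet (h : SmallParam p q r δ ε) (hc : ‖c‖ ≤ ε) :
    IsCompact (perturbedSet p q c) :=
  (isCompact_orbitSet (isCompact_sphere 0 1)).image_of_continuousOn
    ((continuous_apply 0).comp_continuousOn (h.continuousOn_motionOrbit hc))

theorem motionOrbit_mem_perturbedSet (hζ : ζ ∈ circleOrbits p q) (n : ℕ) :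
    motionOrbit (q / p) c ζ n ∈ perturbedSet p q c := by
  have h1 := orbitShift_iterate (motionOrbit (q / p) c ζ) n 0
  rw [motionOrbit_shift_iterate, zero_add] at h1
  exact ⟨orbitShift^[n] ζ, hζ.shift_iterate n, h1⟩

theorem isOrbitIn_motionOrbit (h : SmallParam p q r δ ε) (hc : ‖c‖ ≤ ε)
    (hζ : ζ ∈ circleOrbits p q) :
    IsOrbitIn p q c (perturbedSet p q c) (motionOrbit (q / p) c ζ) :=
  ⟨motionOrbit_mem_perturbedSet hζ, h.contraction.corr_motionOrbit h.p_ne_zero hc hζ⟩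

/-- Bounded orbits outside the trapping disk are displaced orbits. -/
theorem exists_motionOrbit_eq (h : SmallParam p q r δ ε) (hc : ‖c‖ ≤ ε) {w : ℕ → ℂ} {R : ℝ}
    (hw : ∀ n, Corr p q c (w n) (w (n + 1))) (hwρ : ∀ n, trapRadius p q ≤ ‖w n‖)
    (hwR : ∀ n, ‖w n‖ ≤ R) : ∃ ζ ∈ circleOrbits p q, motionOrbit (q / p) c ζ = w :=
  h.contraction.exists_motionOrbit_eq h.p_ne_zero h.ne_zero hc h.trap_pos
    (by linarith [h.two_mul_le]) hw hwρ hwR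

theorem trap_lt_norm (h : SmallParam p q r δ ε) (hc : ‖c‖ ≤ ε) {z : ℂ}
    (hz : z ∈ perturbedSet p q c) :
    trapRadius p q + (1 - trapRadius p q) / 2 ≤ ‖z‖ := by
  have := (abs_le.1 (h.abs_norm_le hc hz)).1
  linarith [h.trap_le]

theorem norm_le_two (h : SmallParam p q r δ ε) (hc : ‖c‖ ≤ ε) {z : ℂ}
    (hz : z ∈ perturbedSet p q c) : ‖z‖ ≤ 2 := by
  have := (abs_le.1 (h.abs_norm_le hc hz)).2
  linarith [h.trap_le, h.trap_lt_one, h.trap_pos]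

/-- A priori, arrows between points of the perturbed set could form further orbits; shadowing
excludes this. Hence the motion is onto the bundle over the perturbed set. -/
theorem orbitSet_perturbedSet (h : SmallParam p q r δ ε) (hc : ‖c‖ ≤ ε) :
    orbitSet p q c (perturbedSet p q c) = motionOrbit (q / p) c '' circleOrbits p q := by
  apply Subset.antisymm
  · intro w hw
    obtain ⟨ζ, hζ, e⟩ := h.exists_motionOrbit_eq hc hw.2
      (fun n => by linarith [h.trap_lt_norm hc (hw.1 n), h.trap_lt_one])
      (fun n => h.norm_le_two hc (hw.1 n))
    exact ⟨ζ, hζ, e⟩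
  · rintro _ ⟨ζ, hζ, rfl⟩
    exact h.isOrbitIn_motionOrbit hc hζ

theorem semiInvariant_perturbedSet (h : SmallParam p q r δ ε) (hc : ‖c‖ ≤ ε) :
    SemiInvariant p q c (perturbedSet p q c) := by
  constructor
  · rintro _ ⟨ζ, hζ, rfl⟩
    have := h.isOrbitIn_motionOrbit hc hζ
    exact ⟨_, this.1 1, this.2 0⟩
  · rintro _ ⟨ζ, hζ, rfl⟩
    obtain ⟨ξ, hξ, rfl⟩ := exists_circleOrbit_pred h.p_ne_zero hζ
    have := h.isOrbitIn_motionOrbit hc hξ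
    exact ⟨_, this.1 0, this.2 0⟩

theorem admissible_perturbedSet (h : SmallParam p q r δ ε) (hc : ‖c‖ ≤ ε) :
    Admissible p q c (perturbedSet p q c) r δ := by
  have hr := h.r_pos
  have hann : ∀ z : ℂ, |‖z‖ - 1| ≤ orbitWidth p q ε → z ∈ annulusA r := fun z hz =>
    ⟨by linarith [(abs_le.1 hz).1, h.r_lt], by linarith [(abs_le.1 hz).2, h.lt_inv]⟩
  refine ⟨hr, ?_, ⟨h.isCompact_perturbedSet hc, h.semiInvariant_perturbedSet hc, fun z hz =>
    ⟨hann z (h.abs_norm_le hc hz), hann _ (h.abs_norm_sub_le hc hz)⟩⟩, h.delta_pos,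
    fun z hz w hw hzw => ⟨?_, fun w' hw' hzw' hne => ?_⟩⟩
  · refine lt_of_le_of_lt ?_ h.mul_lt
    exact mul_le_mul_of_nonneg_right (by linarith) hr.le
  · refine Metric.closedBall_subset_closedBall' ?_
    rw [dist_zero_right, norm_mul, Complex.norm_real, Real.norm_of_nonneg hr.le]
    have h1 : ‖w‖ ≤ 1 + orbitWidth p q ε := by linarith [(abs_le.1 (h.abs_norm_le hc hw)).2]
    linarith [mul_le_mul_of_nonneg_left h1 hr.le, h.add_le]
  · rw [disjoint_closedBall_closedBall_iff h.delta_pos.le h.delta_pos.le, dist_eq_norm, ← mul_sub,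
      norm_mul, Complex.norm_real, Real.norm_of_nonneg hr.le]
    have h1 : 1 - orbitWidth p q ε ≤ ‖w - c‖ := by
      linarith [(abs_le.1 (h.abs_norm_sub_le hc hw)).1]
    have h0 : w - c ≠ 0 := norm_pos_iff.1 (by linarith [h.r_lt])
    -- Two images of the same point differ, after subtracting c, by a root of unity ω ≠ 1, so |w -
    -- w'| = |w - c| |ω - 1|.
    have h2 := h.separated ((w' - c) / (w - c))
      (by show _ ^ q = 1; rw [div_pow, hzw', ← hzw, div_self (pow_ne_zero q h0)])
      (fun e => hne (sub_left_injective ((div_eq_one_iff_eq h0).1 e)))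
    rw [div_sub_one h0, sub_sub_sub_cancel_right, norm_div, norm_sub_rev] at h2
    have h3 : (1 - orbitWidth p q ε) * (r * (‖w - w'‖ / ‖w - c‖)) ≤ r * ‖w - w'‖ := by
      have h4 : 0 < ‖w - c‖ := norm_pos_iff.2 h0
      calc _ ≤ ‖w - c‖ * (r * (‖w - w'‖ / ‖w - c‖)) :=
            mul_le_mul_of_nonneg_right h1 (by positivity)
        _ = _ := by field_simp
    linarith

/-- In the metric |dz|/|z| a branch is stretched by |φ - c|/(κ|φ|). Outside the trapping disk |c| ≤
(1 - κ)|φ|/2, so this is at least (1 + κ)/(2κ) > 1. -/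
theorem isExpandingHyperbolic_perturbedSet (h : SmallParam p q r δ ε) (hc : ‖c‖ ≤ ε) :
    IsExpandingHyperbolic p q c (perturbedSet p q c) := by
  have hρ := h.trap_pos
  have hκ0 := h.contraction.pos
  have hκ1 := h.contraction.lt_one
  have hV : ∀ z : ℂ, trapRadius p q < ‖z‖ → z ≠ 0 := fun z hz => norm_pos_iff.1 (hρ.trans hz)
  refine ⟨h.isCompact_perturbedSet hc, fun h0 => ?_, h.semiInvariant_perturbedSet hc,
    {z | trapRadius p q < ‖z‖}, fun z => ‖z‖⁻¹, isOpen_lt continuous_const continuous_norm, ?_,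
    fun z hz => ?_, ?_, fun z hz => inv_pos.2 (hρ.trans hz), (1 + q / p) / (2 * (q / p)), ?_,
    fun z hz φ hφ hφV => ?_⟩
  · have := h.trap_lt_norm hc h0
    rw [norm_zero] at this
    linarith [h.trap_lt_one]
  · have himg : {z : ℂ | trapRadius p q < ‖z‖} =
        Complex.exp '' {s : ℂ | Real.log (trapRadius p q) < s.re} := by
      apply Subset.antisymm
      · intro z hz
        refine ⟨Complex.log z, ?_, Complex.exp_log (hV z hz)⟩
        show _ < (Complex.log z).re
        rw [Complex.log_re]
        exact Real.log_lt_log hρ hz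
      · rintro _ ⟨s, hs, rfl⟩
        show _ < ‖_‖
        rw [Complex.norm_exp]
        exact (Real.log_lt_iff_lt_exp hρ).1 hs
    rw [himg]
    have hconn : IsConnected {s : ℂ | Real.log (trapRadius p q) < s.re} :=
      ⟨⟨(Real.log (trapRadius p q) + 1 : ℝ), by simp⟩, (convex_halfSpace_re_gt _).isPreconnected⟩
    exact hconn.image _ Complex.continuous_exp.continuousOn
  · show _ < ‖z‖
    linarith [h.trap_lt_norm hc hz, h.trap_lt_one]
  · exact continuous_norm.continuousOn.inv₀ fun z hz => norm_ne_zero_iff.2 (hV z hz)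
  · rw [lt_div_iff₀ (by positivity)]
    linarith
  · have hz0 : 0 < ‖z‖ := hρ.trans hz
    have hφ0 : 0 < ‖φ z‖ := hρ.trans hφV
    rw [hφ.deriv_eq h.ne_zero h.p_ne_zero (hV z hz), norm_mul, norm_div, norm_div,
      Complex.norm_natCast, Complex.norm_natCast]
    have h1 : ‖φ z‖ - ‖c‖ ≤ ‖φ z - c‖ := norm_sub_norm_le _ _
    have h2 : 2 * ‖c‖ ≤ (1 - q / p) * ‖φ z‖ := by
      have := mul_le_mul_of_nonneg_left (show trapRadius p q ≤ ‖φ z‖ from hφV.le)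
        (show 0 ≤ 1 - (q / p : ℝ) by linarith)
      linarith [h.two_mul_le]
    have hp : (0 : ℝ) < p := Nat.cast_pos.2 (Nat.pos_of_ne_zero h.p_ne_zero)
    have hq : (0 : ℝ) < q := Nat.cast_pos.2 (Nat.pos_of_ne_zero h.ne_zero)
    have e : ‖φ z‖⁻¹ * ((p : ℝ) / q * (‖φ z - c‖ / ‖z‖)) / ‖z‖⁻¹ =
        ‖φ z - c‖ / (q / p * ‖φ z‖) := by field_simp
    rw [e, div_le_div_iff₀ (by positivity) (by positivity)]
    calc (1 + (q : ℝ) / p) * (q / p * ‖φ z‖) = (q / p) * ((1 + q / p) * ‖φ z‖) := by ring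
      _ ≤ (q / p) * (2 * ‖φ z - c‖) := mul_le_mul_of_nonneg_left (by linarith) hκ0.le
      _ = _ := by ring

end SmallParam

/-! ### The Julia sets of the perturbed correspondences -/

theorem hasDerivAt_branchComp {φ : ℕ → ℂ → ℂ} {z : ℕ → ℂ} {n : ℕ}
    (h : ∀ k < n, DifferentiableAt ℂ (φ k) (z k) ∧ φ k (z k) = z (k + 1)) {k : ℕ} (hk : k ≤ n) :
    branchComp φ k (z 0) = z k ∧
      HasDerivAt (branchComp φ k) (∏ i ∈ Finset.range k, deriv (φ i) (z i)) (z 0) := by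
  induction k with
  | zero => exact ⟨rfl, by simpa [branchComp] using hasDerivAt_id (z 0)⟩
  | succ k ih =>
    obtain ⟨h1, h2⟩ := ih (by omega)
    obtain ⟨h3, h4⟩ := h k (by omega)
    refine ⟨by simp [branchComp, h1, h4], ?_⟩
    rw [Finset.prod_range_succ, mul_comm]
    exact HasDerivAt.comp (z 0) (h1.symm ▸ h3.hasDerivAt) h2

namespace SmallParam

variable {p q : ℕ} {r δ ε : ℝ} {c : ℂ} {ζ : ℕ → ℂ}

theorem norm_deriv_branch (h : SmallParam p q r δ ε) {φ : ℂ → ℂ} {z : ℂ}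
    (hφ : IsBranchAt p q c φ z) (hz : z ≠ 0) :
    ‖deriv φ z‖ = ‖φ z - c‖ / (q / p * ‖z‖) := by
  have hz' := norm_ne_zero_iff.2 hz
  have hp : (p : ℝ) ≠ 0 := Nat.cast_ne_zero.2 h.p_ne_zero
  have hq : (q : ℝ) ≠ 0 := Nat.cast_ne_zero.2 h.ne_zero
  rw [hφ.deriv_eq h.ne_zero h.p_ne_zero hz, norm_mul, norm_div, norm_div,
    Complex.norm_natCast, Complex.norm_natCast]
  field_simp

/-- Since p ≥ q + 1 and |z| ≤ κ^q, |w - c|^q = |z|^p ≤ |z| |z|^q ≤ (κ|z|)^q. As |φ'| = |φ -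
c|/(κ|z|), this says precisely that branches do not expand there. -/
theorem norm_sub_le_of_trapped (h : SmallParam p q r δ ε) {z w : ℂ} (hzw : Corr p q c z w)
    (hz : ‖z‖ ≤ trapRadius p q) : ‖w - c‖ ≤ q / p * ‖z‖ := by
  have hz1 : ‖z‖ ≤ 1 := hz.trans h.trap_lt_one.le
  have h1 : ‖w - c‖ ^ q = ‖z‖ ^ p := by rw [← norm_pow, hzw, norm_pow]
  refine le_of_pow_le_pow_left₀ h.ne_zero (mul_nonneg h.contraction.pos.le (norm_nonneg z)) ?_
  rw [h1, mul_pow]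
  calc ‖z‖ ^ p ≤ ‖z‖ ^ (q + 1) := pow_le_pow_of_le_one (norm_nonneg z) hz1 h.lt
    _ = ‖z‖ * ‖z‖ ^ q := pow_succ' _ _
    _ ≤ _ := mul_le_mul_of_nonneg_right hz (by positivity)

theorem norm_le_of_trapped (h : SmallParam p q r δ ε) (hc : ‖c‖ ≤ ε) {z w : ℂ}
    (hzw : Corr p q c z w) (hz : ‖z‖ ≤ trapRadius p q) : ‖w‖ ≤ trapRadius p q := by
  have h1 := h.norm_sub_le_of_trapped hzw hz
  have h2 : ‖w‖ ≤ ‖w - c‖ + ‖c‖ := by simpa using norm_add_le (w - c) c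
  have h3 := mul_le_mul_of_nonneg_left hz h.contraction.pos.le
  linarith [h.two_mul_le, h.contraction.eps_pos]

theorem mem_perturbedSet_of_isRepellingCycle (h : SmallParam p q r δ ε) (hc : ‖c‖ ≤ ε) {n : ℕ}
    {z : ℕ → ℂ} (hz : IsRepellingCycle p q c n z) {k : ℕ} (hk : k < n) :
    z k ∈ perturbedSet p q c := by
  obtain ⟨hn, hper, hne, φ, hφ, hderiv⟩ := hz
  have hcorr : ∀ k < n, Corr p q c (z k) (z (k + 1)) := fun k hk => by
    rw [← (hφ k hk).2]; exact (hφ k hk).1.2.self_of_nhds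
  -- Only the indices up to n are constrained by the cycle; reducing modulo n gives an infinite
  -- periodic orbit.
  have hmod : ∀ k, z ((k + 1) % n) = z (k % n + 1) := by
    intro k
    rw [← Nat.mod_add_mod]
    rcases (Nat.succ_le_of_lt (Nat.mod_lt k hn)).lt_or_eq with h1 | h1
    · rw [Nat.mod_eq_of_lt h1]
    · rw [Nat.succ_eq_add_one] at h1
      rw [h1, Nat.mod_self, hper]
  have hcorr' : ∀ k, Corr p q c (z (k % n)) (z ((k + 1) % n)) := fun k => by
    rw [hmod]; exact hcorr _ (Nat.mod_lt k hn)
  by_cases hex : ∃ k, ‖z (k % n)‖ ≤ trapRadius p q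
  · exfalso
    obtain ⟨k₀, hk₀⟩ := hex
    have htrap : ∀ j, ‖z ((k₀ + j) % n)‖ ≤ trapRadius p q := by
      intro j
      induction j with
      | zero => exact hk₀
      | succ j ih => exact h.norm_le_of_trapped hc (hcorr' (k₀ + j)) ih
    have hall : ∀ i < n, ‖z i‖ ≤ trapRadius p q := by
      intro i hi
      -- Going around the cycle far enough from k₀ reaches index i; n ≥ 1 ensures that the natural
      -- subtraction is not truncated.
      have h1 := htrap (n * k₀ + i - k₀)
      have h2 : k₀ ≤ n * k₀ := Nat.le_mul_of_pos_left k₀ hn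
      rwa [Nat.add_sub_cancel' (by omega), Nat.mul_add_mod, Nat.mod_eq_of_lt hi] at h1
    have hd := (hasDerivAt_branchComp (fun k hk =>
      ⟨(hφ k hk).1.1.differentiableAt, (hφ k hk).2⟩) le_rfl).2.deriv
    rw [hd, norm_prod] at hderiv
    refine absurd hderiv (not_lt.2 (Finset.prod_le_one (fun _ _ => norm_nonneg _) fun i hi => ?_))
    have hi' := Finset.mem_range.1 hi
    rw [h.norm_deriv_branch (hφ i hi').1 (hne i hi'), (hφ i hi').2]
    exact div_le_one_of_le₀ (h.norm_sub_le_of_trapped (hcorr i hi') (hall i hi'))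
      (mul_nonneg h.contraction.pos.le (norm_nonneg _))
  · push Not at hex
    obtain ⟨ζ, hζ, e⟩ := h.exists_motionOrbit_eq hc (w := fun k => z (k % n))
      (R := ∑ i ∈ Finset.range n, ‖z i‖) hcorr' (fun k => (hex k).le) fun k =>
        Finset.single_le_sum (f := fun i => ‖z i‖) (fun _ _ => norm_nonneg _)
          (Finset.mem_range.2 (Nat.mod_lt k hn))
    have h1 := congrFun e k
    simp only [Nat.mod_eq_of_lt hk] at h1
    rw [← h1]
    exact motionOrbit_mem_perturbedSet hζ k

theorem isRepellingCycle_motionOrbit (h : SmallParam p q r δ ε) (hc : ‖c‖ ≤ ε)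
    (hζ : ζ ∈ circleOrbits p q) {m : ℕ} (hm : 1 ≤ m) (hper : orbitShift^[m] ζ = ζ) :
    IsRepellingCycle p q c m (motionOrbit (q / p) c ζ) := by
  have horb := h.isOrbitIn_motionOrbit hc hζ
  have hz0 : ∀ n, motionOrbit (q / p) c ζ n ≠ 0 := fun n =>
    motionOrbit_ne_zero (circleOrbits_subset_unitSeqs hζ) n
  have hbr : ∀ k, IsBranchAt p q c (corrBranch p q c (motionOrbit (q / p) c ζ k)
      (motionOrbit (q / p) c ζ (k + 1))) (motionOrbit (q / p) c ζ k) := fun k =>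
    isBranchAt_corrBranch h.ne_zero (hz0 k) (horb.2 k)
  refine ⟨hm, ?_, fun k _ => hz0 k, fun k => corrBranch p q c (motionOrbit (q / p) c ζ k)
      (motionOrbit (q / p) c ζ (k + 1)), fun k _ => ⟨hbr k, corrBranch_self (hz0 k)⟩, ?_⟩
  · have h1 := orbitShift_iterate (motionOrbit (q / p) c ζ) m 0
    rw [motionOrbit_shift_iterate, hper, zero_add] at h1
    exact h1.symm
  · rw [(hasDerivAt_branchComp (n := m) (fun k _ => ⟨(hbr k).1.differentiableAt,
      corrBranch_self (hz0 k)⟩) le_rfl).2.deriv, norm_prod]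
    -- A lower bound for every factor |z_{i+1} - c|/(κ|z_i|) of the multiplier.
    set b : ℝ := (1 - orbitWidth p q ε) / (q / p * (1 + orbitWidth p q ε)) with hb
    have hpos : 0 < (q / p : ℝ) * (1 + orbitWidth p q ε) := by
      have h1 := (abs_nonneg _).trans (h.abs_norm_le hc (horb.1 0))
      have := h.contraction.pos
      positivity
    have hb1 : 1 < b := (one_lt_div hpos).2 h.expanding
    calc 1 < b ^ m := one_lt_pow₀ hb1 (by omega)
      _ = ∏ i ∈ Finset.range m, b := by simp
      _ ≤ _ := Finset.prod_le_prod (fun _ _ => by linarith) fun i _ => ?_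
    rw [h.norm_deriv_branch (hbr i) (hz0 i), corrBranch_self (hz0 i), hb]
    have h1 := (abs_le.1 (h.abs_norm_sub_le hc (horb.1 (i + 1)))).1
    have h2 := (abs_le.1 (h.abs_norm_le hc (horb.1 i))).2
    have h3 := h.contraction.pos
    have h4 := norm_pos_iff.2 (hz0 i)
    refine div_le_div₀ (norm_nonneg _) (by linarith) (by positivity) ?_
    exact mul_le_mul_of_nonneg_left (by linarith) h3.le

theorem juliaSet_eq (h : SmallParam p q r δ ε) (hc : ‖c‖ ≤ ε) :
    juliaSet p q c = perturbedSet p q c := by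
  apply Subset.antisymm
  · refine closure_minimal ?_ (h.isCompact_perturbedSet hc).isClosed
    rintro _ ⟨n, z, hz, k, hk, rfl⟩
    exact h.mem_perturbedSet_of_isRepellingCycle hc hz hk
  · rintro _ ⟨ζ, hζ, rfl⟩
    obtain ⟨ξ, hξ, hlim⟩ := exists_tendsto_periodic h.coprime h.lt h.ne_zero hζ
    have h1 := ((continuous_apply 0).comp_continuousOn (h.continuousOn_motionOrbit hc) ζ hζ).tendsto.comp
      (tendsto_nhdsWithin_iff.2 ⟨hlim, Eventually.of_forall fun N => (hξ N).1⟩)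
    refine mem_closure_of_tendsto h1 (Eventually.of_forall fun N => ?_)
    obtain ⟨m, hm, hper⟩ := (hξ N).2
    exact ⟨m, _, h.isRepellingCycle_motionOrbit hc (hξ N).1 hm hper, 0, by omega, rfl⟩

theorem cantorBundle_perturbedSet (h : SmallParam p q r δ ε) (hc : ‖c‖ ≤ ε) :
    cantorBundle p q c (perturbedSet p q c) r δ =
      (fun ζ => bundlePoint r δ (motionOrbit (q / p) c ζ)) '' circleOrbits p q := by
  rw [(h.admissible_perturbedSet hc).cantorBundle_eq, h.orbitSet_perturbedSet hc, image_image]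

theorem continuousOn_bundlePoint_motionOrbit (h : SmallParam p q r δ ε) (hc : ‖c‖ ≤ ε) :
    ContinuousOn (fun ζ => bundlePoint r δ (motionOrbit (q / p) c ζ)) (circleOrbits p q) :=
  (h.admissible_perturbedSet hc).continuousOn_bundlePoint.comp (h.continuousOn_motionOrbit hc)
    fun _ hζ => h.isOrbitIn_motionOrbit hc hζ

theorem cantorBundle_subset_closurePeriodic (h : SmallParam p q r δ ε) (hc : ‖c‖ ≤ ε) {η : ℝ}
    {f : ℂ × ℂ → ℂ × ℂ} (hf : IsBundleMap p q c (perturbedSet p q c) r δ η f) :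
    cantorBundle p q c (perturbedSet p q c) r δ ⊆
      closurePeriodic (Metric.thickening η (cantorBundle p q c (perturbedSet p q c) r δ)) f := by
  have hA := h.admissible_perturbedSet hc
  rw [h.cantorBundle_perturbedSet hc]
  rintro _ ⟨ζ, hζ, rfl⟩
  obtain ⟨ξ, hξ, hlim⟩ := exists_tendsto_periodic h.coprime h.lt h.ne_zero hζ
  have h1 := (h.continuousOn_bundlePoint_motionOrbit hc ζ hζ).tendsto.comp
    (tendsto_nhdsWithin_iff.2 ⟨hlim, Eventually.of_forall fun N => (hξ N).1⟩)
  refine mem_closure_of_tendsto h1 (Eventually.of_forall fun N => ?_)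
  obtain ⟨hξN, m, hm, hper⟩ := hξ N
  have horb := h.isOrbitIn_motionOrbit hc hξN
  refine ⟨m, hm, fun k _ => ?_, ?_⟩
  · show f^[k] (bundlePoint r δ (motionOrbit (q / p) c (ξ N))) ∈ _
    rw [hf.iterate_bundlePoint hA horb, motionOrbit_shift_iterate]
    exact Metric.self_subset_thickening hf.1 _ ⟨_, hξN.shift_iterate k, rfl⟩
  · show f^[m] (bundlePoint r δ (motionOrbit (q / p) c (ξ N))) = _
    rw [hf.iterate_bundlePoint hA horb, motionOrbit_shift_iterate, hper]
    rfl

/-- The bound on η keeps the first coordinates of a cycle outside the trapping disk, so they form a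
displaced orbit. The second coordinates satisfy the recursion of the encoding and are bounded. -/
theorem closurePeriodic_subset_cantorBundle (h : SmallParam p q r δ ε) (hc : ‖c‖ ≤ ε) {η : ℝ}
    (hη : η ≤ (1 - trapRadius p q) / 2) {f : ℂ × ℂ → ℂ × ℂ}
    (hf : IsBundleMap p q c (perturbedSet p q c) r δ η f) :
    closurePeriodic (Metric.thickening η (cantorBundle p q c (perturbedSet p q c) r δ)) f ⊆
      cantorBundle p q c (perturbedSet p q c) r δ := by
  have hA := h.admissible_perturbedSet hc
  refine closure_minimal ?_ hA.isCompact_cantorBundle.isClosed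
  rintro x ⟨n, hn, hW, hx⟩
  have hη1 : η ≤ 1 := by linarith [h.trap_pos]
  have hstep : ∀ k, trapRadius p q ≤ ‖(f^[k] x).1‖ ∧ ‖(f^[k] x).1‖ ≤ 3 ∧ ‖(f^[k] x).2‖ ≤ 2 ∧
      Corr p q c (f^[k] x).1 (f^[k + 1] x).1 ∧
      (f^[k] x).2 = r * (f^[k + 1] x).1 + δ * (f^[k + 1] x).2 := by
    intro k
    have hk : f^[k] x ∈ Metric.thickening η (cantorBundle p q c (perturbedSet p q c) r δ) := by
      rw [← Function.IsPeriodicPt.iterate_mod_apply (n := n) hx k]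
      exact hW _ (Nat.mod_lt k hn)
    obtain ⟨b, hb, hd⟩ := Metric.mem_thickening_iff.1 hk
    rw [hA.cantorBundle_eq] at hb
    obtain ⟨ζ, hζ, rfl⟩ := hb
    obtain ⟨φ, -, hφ, -, hfφ⟩ := hf.2 ζ hζ
    have hd1 : dist (f^[k] x).1 (ζ 0) < η := (le_max_left _ _).trans_lt hd
    have hd2 : dist (f^[k] x).2 (bundlePoint r δ ζ).2 < η := (le_max_right _ _).trans_lt hd
    have hfk := hfφ _ hd
    rw [← Function.iterate_succ_apply' f] at hfk
    rw [dist_eq_norm] at hd1 hd2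
    have hz1 := h.trap_lt_norm hc (hζ.1 0)
    have hz2 := h.norm_le_two hc (hζ.1 0)
    have hs := hA.norm_bundlePoint_snd_le hζ
    have t1 := norm_sub_norm_le (f^[k] x).1 (ζ 0)
    have t2 := norm_sub_norm_le (ζ 0) (f^[k] x).1
    have t3 := norm_sub_norm_le (f^[k] x).2 (bundlePoint r δ ζ).2
    rw [norm_sub_rev] at t2
    refine ⟨by linarith, by linarith, by linarith, ?_, ?_⟩
    · rw [hfk]
      exact hφ _ (mem_ball_iff_norm.2 hd1)
    · rw [hfk]
      have hδ : (δ : ℂ) ≠ 0 := Complex.ofReal_ne_zero.2 h.delta_pos.ne'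
      simp only
      field_simp
      ring
  obtain ⟨ζ, hζ, e⟩ := h.exists_motionOrbit_eq hc (w := fun k => (f^[k] x).1) (R := 3)
    (fun k => (hstep k).2.2.2.1) (fun k => (hstep k).1) fun k => (hstep k).2.1
  have horb := h.isOrbitIn_motionOrbit hc hζ
  rw [e] at horb
  have hδ0 := h.delta_pos
  -- The deviation from the encoded point is multiplied by 1/δ at each step but stays at most 2 + 1,
  -- so it is zero.
  have key := le_div_of_le_add_mul (lam := δ) (A := 0) (B := 3)
    (a := fun k => ‖(f^[k] x).2 - (bundlePoint r δ (orbitShift^[k] fun k => (f^[k] x).1)).2‖)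
    hδ0.le h.delta_lt_one (fun k => (norm_sub_le _ _).trans (by
      linarith [(hstep k).2.2.1, hA.norm_bundlePoint_snd_le (horb.shift_iterate k)]))
    (fun k => by
      rw [hA.snd_bundlePoint (horb.shift_iterate k), (hstep k).2.2.2.2, orbitShift_iterate,
        add_comm 1 k, add_sub_add_left_eq_sub, ← mul_sub, norm_mul, Complex.norm_real,
        Real.norm_of_nonneg hδ0.le, zero_add, ← Function.iterate_succ_apply' orbitShift]) 0
  rw [zero_div] at key
  rw [hA.cantorBundle_eq]
  exact ⟨_, horb, Prod.ext rfl (sub_eq_zero.1 (norm_le_zero_iff.1 key)).symm⟩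

theorem isBundleJulia (h : SmallParam p q r δ ε) (hc : ‖c‖ ≤ ε) :
    IsBundleJulia p q c (perturbedSet p q c) r δ (cantorBundle p q c (perturbedSet p q c) r δ) := by
  obtain ⟨η, f, hf⟩ := (h.admissible_perturbedSet hc).exists_isBundleMap h.ne_zero
  have hpos : 0 < (1 - trapRadius p q) / 2 := by linarith [h.trap_lt_one]
  refine ⟨min η ((1 - trapRadius p q) / 2), ⟨f, hf.mono (lt_min hf.1 hpos) (min_le_left _ _)⟩,
    fun η' hη' f' hf' => Subset.antisymm ?_ ?_⟩
  · exact h.closurePeriodic_subset_cantorBundle hc (hη'.trans (min_le_right _ _)) hf'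
  · exact h.cantorBundle_subset_closurePeriodic hc hf'

end SmallParam

/-! ### The holomorphic motion of the bundle over the circle -/

/-- A continuous injection of a compact set is closed onto its image, so its inverse is continuous.
With g the encoding, this yields continuity of h_c. -/
theorem ContinuousOn.comp_invFunOn {X Y Z : Type*} [TopologicalSpace X] [TopologicalSpace Y]
    [TopologicalSpace Z] [Nonempty X] [T2Space X] [T2Space Y] {K : Set X} {g : X → Y} {F : X → Z}
    (hK : IsCompact K) (hg : ContinuousOn g K) (hinj : InjOn g K) (hF : ContinuousOn F K) :
    ContinuousOn (fun y => F (Function.invFunOn g K y)) (g '' K) := by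
  rw [continuousOn_iff_isClosed]
  intro t ht
  have hKt : IsCompact (K ∩ F ⁻¹' t) :=
    hK.of_isClosed_subset (hF.preimage_isClosed_of_isClosed hK.isClosed ht) inter_subset_left
  refine ⟨g '' (K ∩ F ⁻¹' t),
    (hKt.image_of_continuousOn (hg.mono inter_subset_left)).isClosed, ?_⟩
  ext y
  constructor
  · rintro ⟨hy, x, hx, rfl⟩
    refine ⟨⟨x, ⟨hx, ?_⟩, rfl⟩, x, hx, rfl⟩
    have : F (Function.invFunOn g K (g x)) ∈ t := hy
    rwa [hinj.leftInvOn_invFunOn hx] at this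
  · rintro ⟨⟨x, ⟨hx, hxt⟩, rfl⟩, hy⟩
    refine ⟨?_, hy⟩
    show F (Function.invFunOn g K (g x)) ∈ t
    rwa [hinj.leftInvOn_invFunOn hx]

/-- The motion that sends the point encoding an orbit on the circle to the point encoding the
displaced orbit. -/
noncomputable def bundleMotion (p q : ℕ) (r δ : ℝ) (c : ℂ) (x : ℂ × ℂ) : ℂ × ℂ :=
  bundlePoint r δ (motionOrbit (q / p) c
    (Function.invFunOn (bundlePoint r δ) (circleOrbits p q) x))

namespace SmallParam

variable {p q : ℕ} {r δ ε : ℝ} {c : ℂ} {ζ : ℕ → ℂ}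

theorem bundleMotion_bundlePoint (hA : Admissible p q 0 (Metric.sphere 0 1) r δ)
    (hζ : ζ ∈ circleOrbits p q) :
    bundleMotion p q r δ c (bundlePoint r δ ζ) = bundlePoint r δ (motionOrbit (q / p) c ζ) := by
  rw [bundleMotion, hA.injOn_bundlePoint.leftInvOn_invFunOn hζ]

theorem image_bundleMotion (h : SmallParam p q r δ ε) (hc : ‖c‖ ≤ ε)
    (hA : Admissible p q 0 (Metric.sphere 0 1) r δ) :
    bundleMotion p q r δ c '' cantorBundle p q 0 (Metric.sphere 0 1) r δ =
      cantorBundle p q c (perturbedSet p q c) r δ := by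
  rw [h.cantorBundle_perturbedSet hc, hA.cantorBundle_eq, image_image]
  exact image_congr fun ζ hζ => bundleMotion_bundlePoint hA hζ

theorem fst_image_bundleMotion (h : SmallParam p q r δ ε) (hc : ‖c‖ ≤ ε)
    (hA : Admissible p q 0 (Metric.sphere 0 1) r δ) :
    Prod.fst '' (bundleMotion p q r δ c '' cantorBundle p q 0 (Metric.sphere 0 1) r δ) =
      perturbedSet p q c := by
  rw [h.image_bundleMotion hc hA, h.cantorBundle_perturbedSet hc, image_image]
  rfl

theorem perturbedSet_zero (h : SmallParam p q r δ ε) :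
    perturbedSet p q 0 = Metric.sphere 0 1 := by
  ext z
  constructor
  · rintro ⟨ζ, hζ, rfl⟩
    simp only [h.contraction.motionOrbit_zero (circleOrbits_subset_unitSeqs hζ)]
    exact hζ.1 0
  · intro hz
    obtain ⟨ζ, hζ, rfl⟩ := exists_circleOrbit (p := p) h.ne_zero (mem_sphere_zero_iff_norm.1 hz)
    refine ⟨ζ, hζ, ?_⟩
    simp only [h.contraction.motionOrbit_zero (circleOrbits_subset_unitSeqs hζ)]

theorem isHolomorphicMotion (h : SmallParam p q r δ ε)
    (hA : Admissible p q 0 (Metric.sphere 0 1) r δ) :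
    IsHolomorphicMotion (Metric.ball 0 ε) (cantorBundle p q 0 (Metric.sphere 0 1) r δ) 0
      (bundleMotion p q r δ) where
  isOpen := Metric.isOpen_ball
  isConnected := ((convex_ball (0 : ℂ) ε).isConnected
    (Metric.nonempty_ball.2 h.contraction.eps_pos))
  base_mem := Metric.mem_ball_self h.contraction.eps_pos
  base_eq x hx := by
    rw [hA.cantorBundle_eq] at hx
    obtain ⟨ζ, hζ, rfl⟩ := hx
    rw [bundleMotion_bundlePoint hA hζ,
      h.contraction.motionOrbit_zero (circleOrbits_subset_unitSeqs hζ)]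
  injOn c hc x hx y hy e := by
    have hc' := (mem_ball_zero_iff.1 hc).le
    rw [hA.cantorBundle_eq] at hx hy
    obtain ⟨ζ, hζ, rfl⟩ := hx
    obtain ⟨ξ, hξ, rfl⟩ := hy
    rw [bundleMotion_bundlePoint hA hζ, bundleMotion_bundlePoint hA hξ] at e
    rw [h.contraction.motionOrbit_injOn hc' (circleOrbits_subset_unitSeqs hζ)
      (circleOrbits_subset_unitSeqs hξ) ((h.admissible_perturbedSet hc').injOn_bundlePoint
        (h.isOrbitIn_motionOrbit hc' hζ) (h.isOrbitIn_motionOrbit hc' hξ) e)]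
  holo x hx := by
    rw [hA.cantorBundle_eq] at hx
    obtain ⟨ζ, hζ, rfl⟩ := hx
    simp only [bundleMotion_bundlePoint hA hζ]
    have hd := h.contraction.differentiableOn_motionOrbit (circleOrbits_subset_unitSeqs hζ)
    refine (hd 0).prodMk (DifferentiableOn.const_mul ?_ _)
    -- The displaced orbits are bounded by 2 uniformly in the parameter, so the encoding series is a
    -- normally convergent series of holomorphic functions of c.
    refine Complex.differentiableOn_tsum_of_summable_norm (u := fun k => δ ^ k * 2)
      ((summable_geometric_of_lt_one h.delta_pos.le h.delta_lt_one).mul_right 2)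
      (fun k => (hd (k + 1)).const_mul _) Metric.isOpen_ball fun k c hc => ?_
    have hc' := (mem_ball_zero_iff.1 hc).le
    exact norm_encoding_term_le h.delta_pos.le (fun n =>
      h.norm_le_two hc' ((h.isOrbitIn_motionOrbit hc' hζ).1 (n + 1))) k

theorem tendsto_hausdorffEDist (h : SmallParam p q r δ ε) (hc : c ∈ Metric.ball 0 ε) :
    Tendsto (fun c' => Metric.hausdorffEDist (perturbedSet p q c') (perturbedSet p q c))
      (𝓝[Metric.ball 0 ε] c) (𝓝 0) := by
  have hlim : Tendsto (fun c' => ENNReal.ofReal (36 / (1 - q / p) * ‖c' - c‖))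
      (𝓝[Metric.ball 0 ε] c) (𝓝 0) := by
    rw [← ENNReal.ofReal_zero]
    refine ENNReal.tendsto_ofReal ?_
    have hcont : Continuous fun c' : ℂ => 36 / (1 - (q / p : ℝ)) * ‖c' - c‖ := by fun_prop
    have := (hcont.tendsto c).mono_left (nhdsWithin_le_nhds (s := Metric.ball 0 ε))
    simpa using this
  refine tendsto_of_tendsto_of_tendsto_of_le_of_le' tendsto_const_nhds hlim
    (Eventually.of_forall fun _ => zero_le) ?_
  filter_upwards [self_mem_nhdsWithin] with c' hc'
  have hle : ∀ ζ ∈ circleOrbits p q, edist (motionOrbit (q / p) c' ζ 0)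
      (motionOrbit (q / p) c ζ 0) ≤ ENNReal.ofReal (36 / (1 - q / p) * ‖c' - c‖) := by
    intro ζ hζ
    rw [edist_dist, dist_eq_norm]
    exact ENNReal.ofReal_le_ofReal (h.contraction.norm_motionOrbit_sub_le
      (mem_ball_zero_iff.1 hc').le (mem_ball_zero_iff.1 hc).le (circleOrbits_subset_unitSeqs hζ) 0)
  refine Metric.hausdorffEDist_le_of_mem_edist ?_ ?_
  · rintro _ ⟨ζ, hζ, rfl⟩
    exact ⟨_, ⟨ζ, hζ, rfl⟩, hle ζ hζ⟩
  · rintro _ ⟨ζ, hζ, rfl⟩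
    exact ⟨_, ⟨ζ, hζ, rfl⟩, by rw [edist_comm]; exact hle ζ hζ⟩

theorem isBundleMotion (h : SmallParam p q r δ ε)
    (hA : Admissible p q 0 (Metric.sphere 0 1) r δ) :
    IsBundleMotion p q 0 (Metric.sphere 0 1) r δ (Metric.ball 0 ε) (bundleMotion p q r δ) where
  motion := h.isHolomorphicMotion hA
  hyperbolic c hc := by
    have hc' := (mem_ball_zero_iff.1 hc).le
    rw [h.fst_image_bundleMotion hc' hA]
    exact h.isExpandingHyperbolic_perturbedSet hc'
  admissible c hc := by
    have hc' := (mem_ball_zero_iff.1 hc).le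
    rw [h.fst_image_bundleMotion hc' hA]
    exact h.admissible_perturbedSet hc'
  hausdorff c hc := by
    refine (h.tendsto_hausdorffEDist hc).congr' ?_
    filter_upwards [self_mem_nhdsWithin] with c' hc'
    rw [h.fst_image_bundleMotion (mem_ball_zero_iff.1 hc).le hA,
      h.fst_image_bundleMotion (mem_ball_zero_iff.1 hc').le hA]
  continuousOn c hc := by
    rw [hA.cantorBundle_eq]
    exact ContinuousOn.comp_invFunOn (isCompact_orbitSet (isCompact_sphere 0 1))
      hA.continuousOn_bundlePoint hA.injOn_bundlePoint
      (h.continuousOn_bundlePoint_motionOrbit (mem_ball_zero_iff.1 hc).le)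
  mapsTo c hc := by
    have hc' := (mem_ball_zero_iff.1 hc).le
    rw [h.fst_image_bundleMotion hc' hA, ← h.image_bundleMotion hc' hA]
    exact mapsTo_image _ _
  conj c hc := by
    have hc' := (mem_ball_zero_iff.1 hc).le
    have hAc := h.admissible_perturbedSet hc'
    obtain ⟨η₀, f₀, hf₀⟩ := hA.exists_isBundleMap h.ne_zero
    obtain ⟨η, f, hf⟩ := hAc.exists_isBundleMap h.ne_zero
    rw [h.fst_image_bundleMotion hc' hA, h.image_bundleMotion hc' hA]
    refine ⟨η₀, η, f₀, f, hf₀, hf, ?_, ?_⟩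
    · rw [hAc.cantorBundle_eq]
      rintro _ ⟨w, hw, rfl⟩
      rw [hf.apply_bundlePoint hAc hw]
      exact ⟨_, hw.shift, rfl⟩
    · rw [hA.cantorBundle_eq]
      rintro _ ⟨ζ, hζ, rfl⟩
      rw [hf₀.apply_bundlePoint hA hζ, bundleMotion_bundlePoint hA hζ.shift,
        bundleMotion_bundlePoint hA hζ,
        hf.apply_bundlePoint hAc (h.isOrbitIn_motionOrbit hc' hζ), motionOrbit_shift]
  lipschitz := by
    have h1 : 0 < 1 - (q / p : ℝ) := by linarith [h.contraction.lt_one]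
    have h2 : 0 < 1 - δ := by linarith [h.delta_lt_one]
    have hr := h.r_pos
    set K : ℝ := 36 / (1 - q / p) with hK
    have hK0 : 0 < K := by positivity
    have hL0 : 0 < r * ((1 - δ)⁻¹ * K) := by positivity
    refine ⟨K + r * ((1 - δ)⁻¹ * K), by positivity, fun u hu v hv x hx => ?_⟩
    rw [hA.cantorBundle_eq] at hx
    obtain ⟨ζ, hζ, rfl⟩ := hx
    have hu' := (mem_ball_zero_iff.1 hu).le
    have hv' := (mem_ball_zero_iff.1 hv).le
    rw [bundleMotion_bundlePoint hA hζ, bundleMotion_bundlePoint hA hζ]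
    refine (norm_bundlePoint_sub_le (M := K * ‖u - v‖) (M' := 2) hr.le h.delta_pos.le
      h.delta_lt_one (fun n => h.norm_le_two hu' ((h.isOrbitIn_motionOrbit hu' hζ).1 _))
      (fun n => h.norm_le_two hv' ((h.isOrbitIn_motionOrbit hv' hζ).1 _))
      (h.contraction.norm_motionOrbit_sub_le hu' hv' (circleOrbits_subset_unitSeqs hζ))).trans ?_
    have hn := norm_nonneg (u - v)
    refine max_le ?_ ?_
    · exact mul_le_mul_of_nonneg_right (by linarith) hn
    · calc r * ((1 - δ)⁻¹ * (K * ‖u - v‖)) = r * ((1 - δ)⁻¹ * K) * ‖u - v‖ := by ring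
        _ ≤ _ := mul_le_mul_of_nonneg_right (by linarith) hn

end SmallParam

/-! ### Numerator and denominator of β, and the final assembly. -/

theorem numNat_facts {β : ℚ} (hβ : 1 < β) (hβZ : ∀ m : ℤ, β ≠ m) :
    (numNat β).Coprime β.den ∧ β.den < numNat β ∧ 2 ≤ β.den := by
  have hnum : 0 < β.num := Rat.num_pos.2 (by linarith)
  have habs : β.num.natAbs = numNat β := by show _ = β.num.toNat; omega
  refine ⟨habs ▸ β.reduced, ?_, ?_⟩
  · have h1 : (β.den : ℤ) < β.num := by
      have := Rat.lt_iff 1 β |>.1 hβ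
      simpa using this
    show β.den < β.num.toNat
    omega
  · have h1 : β.den ≠ 1 := fun h => hβZ β.num (Rat.den_eq_one_iff β |>.1 h).symm
    have := β.den_pos
    omega

theorem theoremD (β : ℚ) (hβ : 1 < β) (hβZ : ∀ m : ℤ, β ≠ m)
    (r : ℝ) (hr : 0 < r) (hr' : r < 1 / 2) :
    (∃ δ : ℝ, Admissible (numNat β) β.den 0 (Metric.sphere 0 1) r δ) ∧
    ∀ δ : ℝ, Admissible (numNat β) β.den 0 (Metric.sphere 0 1) r δ →
      juliaSet (numNat β) β.den 0 = Metric.sphere 0 1 ∧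
      IsBundleJulia (numNat β) β.den 0 (Metric.sphere 0 1) r δ
        (cantorBundle (numNat β) β.den 0 (Metric.sphere 0 1) r δ) ∧
      Nonempty (cantorBundle (numNat β) β.den 0 (Metric.sphere 0 1) r δ ≃ₜ Solenoid β.den) ∧
      ∃ (U : Set ℂ) (h : ℂ → ℂ × ℂ → ℂ × ℂ),
        IsBundleMotion (numNat β) β.den 0 (Metric.sphere 0 1) r δ U h ∧
        ∀ c ∈ U,
          juliaSet (numNat β) β.den c =
            Prod.fst '' (h c '' cantorBundle (numNat β) β.den 0 (Metric.sphere 0 1) r δ) ∧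
          IsBundleJulia (numNat β) β.den c (juliaSet (numNat β) β.den c) r δ
            (h c '' cantorBundle (numNat β) β.den 0 (Metric.sphere 0 1) r δ) := by
  obtain ⟨hpq, hqp, hq2⟩ := numNat_facts hβ hβZ
  have hq : β.den ≠ 0 := by omega
  have hp : numNat β ≠ 0 := by omega
  refine ⟨exists_admissible_circle hp hq hr hr', fun δ hA => ?_⟩
  obtain ⟨ε, h⟩ := hA.exists_smallParam hpq hqp hq hr' hq2
  have h0 : ‖(0 : ℂ)‖ ≤ ε := by rw [norm_zero]; exact h.contraction.eps_pos.le
  refine ⟨(h.juliaSet_eq h0).trans h.perturbedSet_zero, ?_, nonempty_homeomorph_solenoid hpq hA,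
    Metric.ball 0 ε, bundleMotion (numNat β) β.den r δ, h.isBundleMotion hA, fun c hc => ?_⟩
  · have := h.isBundleJulia h0
    rwa [h.perturbedSet_zero] at this
  · have hc' := (mem_ball_zero_iff.1 hc).le
    rw [h.juliaSet_eq hc', h.fst_image_bundleMotion hc' hA, h.image_bundleMotion hc' hA]
    exact ⟨rfl, h.isBundleJulia hc'⟩
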